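/- **Model.** Base stations (BSs) sit at the points $X_k$, $k\in\mathbb N$, of a homogeneous Poisson point process on $\mathbb R^2$ with density $\rho>0$; the typical user is at the origin and $R_k=\|X_k\|$. Given the positions, the links are independently line-of-sight (LoS) or not (NLoS), a link of length $R$ being LoS with probability $f_{\Pr}(R)$, where $f_{\Pr}:[0,\infty)\to[0,1]$ is measurable. For link type $s\in\{\mathrm{LoS},\mathrm{NLoS}\}$ the path loss law is $L(R)=\beta_sR^{-\alpha_s}$ with $\beta_s,\alpha_s>0$. The user is served by the BS $o$ with the smallest path loss, i.e. with the largest value of $L(R_k)$. BSs have $M\ge1$ and users $N\ge1$ antennas, forming uniform linear arrays with spacing $d>0$, and the wavelength is $\lambda>0$; the $\ell$-element response vector is $\mathbf a_\ell(\theta)=\big(e^{-j2\pi\frac d\lambda n\sin\theta}\big)_{n=0}^{\ell-1}$. With transmit power $P_{\rm mm}>0$ and reference distance $D>0$, the received power is $P_{r_o}=\mathrm{En}_1+\mathrm{En}_2$, $$\mathrm{En}_1=\tfrac{P_{\rm mm}}{NM}L(\max\{R_o,D\})\big|\mathbf a_N^\dagger(\theta_{r_o})\mathbf a_N(\theta_{r_o})\,\mathbf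 a_M^\dagger(\theta_{t_o})\mathbf a_M(\theta_{t_o})\big|^2,$$ $$\mathrm{En}_2=\tfrac{P_{\rm mm}}{NM}\sum_{k\ne o}L(\max\{R_k,D\})\big|\mathbf a_N^\dagger(\theta_{r_o})\mathbf a_N(\vartheta_{r_k})\,\mathbf a_M^\dagger(\vartheta_{t_k})\mathbf a_M(\theta_{t_k})\big|^2 ,$$ where, for every $k$, the angles $\theta_{r_o},\vartheta_{r_k},\vartheta_{t_k},\theta_{t_k}$ are independent, uniform on $(0,2\pi)$, and jointly independent of all link lengths and LoS states; $\theta_{t_o}$ is arbitrary. **Notation.** $\Theta(x)=\int_0^xtf_{\Pr}(t)\,dt$, $\Xi(x)=\int_0^x(1-f_{\Pr}(t))t\,dt$, $$\varphi_{\rm LoS}(x)=\Big(\tfrac{\beta_{\rm NLoS}}{\beta_{\rm LoS}}\Big)^{1/\alpha_{\rm NLoS}}x^{\alpha_{\rm LoS}/\alpha_{\rm NLoS}},\qquad \varphi_{\rm NLoS}(x)=\Big(\tfrac{\beta_{\rm LoS}}{\beta_{\rm NLoS}}\Big)^{1/\alpha_{\rm LoS}}x^{\alpha_{\rm NLoS}/\alpha_{\rm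 LoS}},$$ $E_{\rm L}(x)=e^{-2\pi\rho[\Theta(x)+\Xi(\varphi_{\rm LoS}(x))]}$, $E_{\rm N}(x)=e^{-2\pi\rho[\Theta(\varphi_{\rm NLoS}(x))+\Xi(x)]}$, $\varpi_{\vartheta,\theta}=2\pi\frac d\lambda(\sin\vartheta-\sin\theta)$, and $$\overline\hbar=\prod_{\ell\in(N,M)}\int_0^{2\pi}\!\!\int_0^{2\pi}\frac{1-\cos(\ell\varpi_{\vartheta,\theta})}{1-\cos\varpi_{\vartheta,\theta}}\,\frac{1}{4\pi^2}\,d\vartheta\,d\theta .$$ **Theorem.** The average received power satisfies $\overline P_{r_o}=\mathbb E[P_{r_o}]=\mathbb E[\mathrm{En}_1]+\mathbb E[\mathrm{En}_2]$. It is bounded below by $\overline P_{r_o}^{\rm Low}=\mathbb E[\mathrm{En}_1]$, which is finite and equals $$\begin{aligned}\overline P^{\rm Low}_{r_o}=NMP_{\rm mm}2\pi\rho\Big\{&\beta_{\rm LoS}D^{-\alpha_{\rm LoS}}\int_0^Dxf_{\Pr}(x)E_{\rm L}(x)\,dx+\beta_{\rm LoS}\int_D^\infty x^{1-\alpha_{\rm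 LoS}}f_{\Pr}(x)E_{\rm L}(x)\,dx\\&+\beta_{\rm NLoS}D^{-\alpha_{\rm NLoS}}\int_0^Dx(1-f_{\Pr}(x))E_{\rm N}(x)\,dx+\beta_{\rm NLoS}\int_D^\infty x^{1-\alpha_{\rm NLoS}}(1-f_{\Pr}(x))E_{\rm N}(x)\,dx\Big\}.\end{aligned}$$ Moreover, as an identity in $[0,\infty]$ (both sides may be infinite when $\alpha_{\rm LoS}$ or $\alpha_{\rm NLoS}$ is small), $$\begin{aligned}\overline P_{r_o}=\overline P^{\rm Low}_{r_o}&+\tfrac{P_{\rm mm}}{NM}\overline\hbar\beta_{\rm LoS}(2\pi\rho)^2\Big\{\int_0^\infty\Big[\int_x^\infty\max\{t,D\}^{-\alpha_{\rm LoS}}f_{\Pr}(t)t\,dt\Big]xf_{\Pr}(x)E_{\rm L}(x)\,dx\\&\quad+\int_0^\infty\Big[\int_{\varphi_{\rm NLoS}(x)}^\infty\max\{t,D\}^{-\alpha_{\rm LoS}}f_{\Pr}(t)t\,dt\Big]x(1-f_{\Pr}(x))E_{\rm N}(x)\,dx\Big\}\\&+\tfrac{P_{\rm mm}}{NM}\overline\hbar\beta_{\rm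 NLoS}(2\pi\rho)^2\Big\{\int_0^\infty\Big[\int_{\varphi_{\rm LoS}(x)}^\infty\max\{t,D\}^{-\alpha_{\rm NLoS}}(1-f_{\Pr}(t))t\,dt\Big]xf_{\Pr}(x)E_{\rm L}(x)\,dx\\&\quad+\int_0^\infty\Big[\int_x^\infty\max\{t,D\}^{-\alpha_{\rm NLoS}}(1-f_{\Pr}(t))t\,dt\Big]x(1-f_{\Pr}(x))E_{\rm N}(x)\,dx\Big\}.\end{aligned}$$ -/

import Mathlib

open MeasureTheory ProbabilityTheory
open scoped ENNReal NNReal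

noncomputable section

namespace MmWave

/-- The plane. -/
abbrev Plane : Type := EuclideanSpace ℝ (Fin 2)

/-- Number of points of the configuration `x` that lie in `B`. -/
def pointCount (x : ℕ → Plane) (B : Set Plane) : ℕ∞ := {k | x k ∈ B}.encard

/-- `X 0, X 1, ...` is an enumeration (with multiplicity) of the points of a homogeneous Poisson
point process on the plane with density `ρ`: the number of points in a Borel set of finite area is
Poisson distributed with mean `ρ` times the area, and the numbers of points in disjoint sets are
independent. (Such a process has almost surely infinitely many points, since `ρ > 0`.) -/
structure IsHomogeneousPPP {Ω : Type*} [MeasurableSpace Ω] (μ : Measure Ω)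
    (ρ : ℝ) (X : ℕ → Ω → Plane) : Prop where
  measurable : ∀ k, Measurable (X k)
  poisson : ∀ B : Set Plane, MeasurableSet B → volume B ≠ ∞ → ∀ n : ℕ,
    μ {ω | pointCount (fun k => X k ω) B = n} =
      ENNReal.ofReal (Real.exp (-(ρ * (volume B).toReal)) * (ρ * (volume B).toReal) ^ n /
        (n.factorial : ℝ))
  indep : ∀ (n : ℕ) (B : Fin n → Set Plane), (∀ i, MeasurableSet (B i)) →
    (∀ i, volume (B i) ≠ ∞) → Pairwise (fun i j => Disjoint (B i) (B j)) →
    iIndepFun (fun i ω => pointCount (fun k => X k ω) (B i)) μ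

/-- The deterministic parameters of the network. -/
structure Params where
  /-- BS density -/
  ρ : ℝ
  /-- number of antennas of a BS -/
  M : ℕ
  /-- number of antennas of a user -/
  N : ℕ
  /-- BS transmit power -/
  Pmm : ℝ
  /-- reference distance -/
  D : ℝ
  βLoS : ℝ
  βNLoS : ℝ
  αLoS : ℝ
  αNLoS : ℝ
  /-- antenna spacing -/
  d : ℝ
  wavelength : ℝ
  /-- LoS probability of a link as a function of its length -/
  fPr : ℝ → ℝ
  ρ_pos : 0 < ρ
  M_pos : 0 < M
  N_pos : 0 < N
  Pmm_pos : 0 < Pmm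
  D_pos : 0 < D
  βLoS_pos : 0 < βLoS
  βNLoS_pos : 0 < βNLoS
  αLoS_pos : 0 < αLoS
  αNLoS_pos : 0 < αNLoS
  d_pos : 0 < d
  wavelength_pos : 0 < wavelength
  fPr_measurable : Measurable fPr
  fPr_mem : ∀ R, 0 ≤ R → fPr R ∈ Set.Icc (0 : ℝ) 1

namespace Params

variable (p : Params)

/-- Path loss law of a link of length `R`; the flag tells whether the link is LoS. -/
def pathLoss (los : Bool) (R : ℝ) : ℝ :=
  if los then p.βLoS * R ^ (-p.αLoS) else p.βNLoS * R ^ (-p.αNLoS)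

/-- Response vector of an `ℓ`-element uniform linear array. -/
def arrayResponse (ℓ : ℕ) (θ : ℝ) : Fin ℓ → ℂ := fun n =>
  Complex.exp (-Complex.I * ((2 * Real.pi * (p.d / p.wavelength) * (n : ℕ) * Real.sin θ : ℝ) : ℂ))

/-- The scalar `a(θ)† a(ϑ)` for an `ℓ`-element array. -/
def arrayProd (ℓ : ℕ) (θ ϑ : ℝ) : ℂ :=
  dotProduct (star (p.arrayResponse ℓ θ)) (p.arrayResponse ℓ ϑ)

end Params

/-- The random elements of the network, seen from the typical user at the origin. -/
structure Network (Ω : Type*) where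
  /-- position of the `k`-th BS -/
  pos : ℕ → Ω → Plane
  /-- whether the link from the `k`-th BS to the typical user is LoS -/
  los : ℕ → Ω → Bool
  /-- AoA at the typical user of the signal of its serving BS (direction of the receive beam) -/
  θr : Ω → ℝ
  /-- AoD at the serving BS of the typical user (direction of the transmit beam of that BS) -/
  θo : Ω → ℝ
  /-- AoA at the typical user of the signal of the `k`-th BS -/
  ϑr : ℕ → Ω → ℝ
  /-- direction of the typical user seen by the `k`-th BS -/
  ϑt : ℕ → Ω → ℝ
  /-- direction of the transmit beam of the `k`-th BS, pointed at its own user -/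
  θt : ℕ → Ω → ℝ

/-- The probabilistic assumptions: the BSs form a homogeneous PPP; given the positions, the links
are independently LoS or NLoS, with LoS probability `fPr` of the link length; the angles that enter
an interfering link are independent, uniform on `(0, 2π)`, and independent of all link lengths
and LoS states. -/
structure Network.IsModel {Ω : Type*} [MeasurableSpace Ω] (W : Network Ω) (p : Params)
    (μ : Measure Ω) : Prop where
  ppp : IsHomogeneousPPP μ p.ρ W.pos
  los_measurable : ∀ k, Measurable (W.los k)
  los_law : ∀ (A : Set (ℕ → Plane)), MeasurableSet A → ∀ (I : Finset ℕ) (b : ℕ → Bool),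
    μ {ω | (fun k => W.pos k ω) ∈ A ∧ ∀ k ∈ I, W.los k ω = b k} =
      ∫⁻ ω in {ω | (fun k => W.pos k ω) ∈ A},
        ∏ k ∈ I, ENNReal.ofReal (if b k then p.fPr ‖W.pos k ω‖ else 1 - p.fPr ‖W.pos k ω‖) ∂μ
  θr_measurable : Measurable W.θr
  ϑr_measurable : ∀ k, Measurable (W.ϑr k)
  ϑt_measurable : ∀ k, Measurable (W.ϑt k)
  θt_measurable : ∀ k, Measurable (W.θt k)
  θr_uniform : pdf.IsUniform W.θr (Set.Ioo 0 (2 * Real.pi)) μ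
  ϑr_uniform : ∀ k, pdf.IsUniform (W.ϑr k) (Set.Ioo 0 (2 * Real.pi)) μ
  ϑt_uniform : ∀ k, pdf.IsUniform (W.ϑt k) (Set.Ioo 0 (2 * Real.pi)) μ
  θt_uniform : ∀ k, pdf.IsUniform (W.θt k) (Set.Ioo 0 (2 * Real.pi)) μ
  angles_indep : ∀ k, iIndepFun ![W.θr, W.ϑr k, W.ϑt k, W.θt k] μ
  angles_indep_links : ∀ k,
    IndepFun (fun ω => (W.θr ω, W.ϑr k ω, W.ϑt k ω, W.θt k ω))
      (fun ω => ((fun j => ‖W.pos j ω‖), (fun j => W.los j ω))) μ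

namespace Network

variable {Ω : Type*} (W : Network Ω) (p : Params)

/-- Length of the link from the `k`-th BS to the typical user. -/
def dist (k : ℕ) (ω : Ω) : ℝ := ‖W.pos k ω‖

/-- The serving BS: the one whose link has the smallest path loss, that is, the largest value of
the path loss law (almost surely there is exactly one; the first one is taken in a tie). -/
def serving (ω : Ω) : ℕ :=
  sInf {k | ∀ j, p.pathLoss (W.los j ω) (W.dist j ω) ≤ p.pathLoss (W.los k ω) (W.dist k ω)}

/-- Power received from the serving BS. -/
def En1 (ω : Ω) : ℝ≥0∞ :=
  ENNReal.ofReal (p.Pmm / (p.N * p.M) *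
    p.pathLoss (W.los (W.serving p ω) ω) (max (W.dist (W.serving p ω) ω) p.D) *
    ‖p.arrayProd p.N (W.θr ω) (W.θr ω) * p.arrayProd p.M (W.θo ω) (W.θo ω)‖ ^ 2)

/-- Power received from all the other BSs. -/
def En2 (ω : Ω) : ℝ≥0∞ :=
  ENNReal.ofReal (p.Pmm / (p.N * p.M)) *
    ∑' k : {k : ℕ // k ≠ W.serving p ω},
      ENNReal.ofReal (p.pathLoss (W.los k ω) (max (W.dist k ω) p.D) *
        ‖p.arrayProd p.N (W.θr ω) (W.ϑr k ω) * p.arrayProd p.M (W.ϑt k ω) (W.θt k ω)‖ ^ 2)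

/-- Power received by the typical user. -/
def receivedPower (ω : Ω) : ℝ≥0∞ := W.En1 p ω + W.En2 p ω

end Network

namespace Params

variable (p : Params)

/-- `2π (d/λ) (sin ϑ - sin θ)` -/
def ϖ (ϑ θ : ℝ) : ℝ := 2 * Real.pi * (p.d / p.wavelength) * (Real.sin ϑ - Real.sin θ)

/-- Mean of `(1 - cos (ℓ ϖ)) / (1 - cos ϖ)` for two independent angles uniform on `(0, 2π)`. -/
def meanPattern (ℓ : ℕ) : ℝ :=
  ∫ θ in (0 : ℝ)..(2 * Real.pi), ∫ ϑ in (0 : ℝ)..(2 * Real.pi),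
    (1 - Real.cos (ℓ * p.ϖ ϑ θ)) / (1 - Real.cos (p.ϖ ϑ θ)) * (1 / (4 * Real.pi ^ 2))

/-- The averaged beam-pattern factor. -/
def hBar : ℝ := p.meanPattern p.N * p.meanPattern p.M

def Θ (x : ℝ) : ℝ := ∫ t in (0 : ℝ)..x, t * p.fPr t

def Ξ (x : ℝ) : ℝ := ∫ t in (0 : ℝ)..x, (1 - p.fPr t) * t

def φLoS (x : ℝ) : ℝ := (p.βNLoS / p.βLoS) ^ (1 / p.αNLoS) * x ^ (p.αLoS / p.αNLoS)

def φNLoS (x : ℝ) : ℝ := (p.βLoS / p.βNLoS) ^ (1 / p.αLoS) * x ^ (p.αNLoS / p.αLoS)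

/-- `exp (-2πρ [Θ(x) + Ξ(φLoS(x))])` -/
def expLoS (x : ℝ) : ℝ := Real.exp (-2 * Real.pi * p.ρ * (p.Θ x + p.Ξ (p.φLoS x)))

/-- `exp (-2πρ [Θ(φNLoS(x)) + Ξ(x)])` -/
def expNLoS (x : ℝ) : ℝ := Real.exp (-2 * Real.pi * p.ρ * (p.Θ (p.φNLoS x) + p.Ξ x))

/-- The closed form of the lower bound, with four (always convergent) integrals. -/
def avgPowerLow : ℝ :=
  p.N * p.M * p.Pmm * (2 * Real.pi * p.ρ) *
    (p.βLoS * p.D ^ (-p.αLoS) * (∫ x in (0 : ℝ)..p.D, x * p.fPr x * p.expLoS x)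
      + p.βLoS * (∫ x in Set.Ioi p.D, x ^ (1 - p.αLoS) * p.fPr x * p.expLoS x)
      + p.βNLoS * p.D ^ (-p.αNLoS) * (∫ x in (0 : ℝ)..p.D, x * (1 - p.fPr x) * p.expNLoS x)
      + p.βNLoS * (∫ x in Set.Ioi p.D, x ^ (1 - p.αNLoS) * (1 - p.fPr x) * p.expNLoS x))

/-- `∫_r^∞ max{t, D}^{-αLoS} f(t) t dt`, possibly infinite. -/
def tailLoS (r : ℝ) : ℝ≥0∞ :=
  ∫⁻ t in Set.Ioi r, ENNReal.ofReal ((max t p.D) ^ (-p.αLoS) * p.fPr t * t)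

/-- `∫_r^∞ max{t, D}^{-αNLoS} (1 - f(t)) t dt`, possibly infinite. -/
def tailNLoS (r : ℝ) : ℝ≥0∞ :=
  ∫⁻ t in Set.Ioi r, ENNReal.ofReal ((max t p.D) ^ (-p.αNLoS) * (1 - p.fPr t) * t)

/-- The double-integral expression for the mean interference power, possibly infinite. -/
def avgInterference : ℝ≥0∞ :=
  ENNReal.ofReal (p.Pmm / (p.N * p.M) * p.hBar * p.βLoS * (2 * Real.pi * p.ρ) ^ 2) *
      ((∫⁻ x in Set.Ioi (0 : ℝ),
          p.tailLoS x * ENNReal.ofReal (x * p.fPr x * p.expLoS x))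
        + ∫⁻ x in Set.Ioi (0 : ℝ),
          p.tailLoS (p.φNLoS x) * ENNReal.ofReal (x * (1 - p.fPr x) * p.expNLoS x))
    + ENNReal.ofReal (p.Pmm / (p.N * p.M) * p.hBar * p.βNLoS * (2 * Real.pi * p.ρ) ^ 2) *
      ((∫⁻ x in Set.Ioi (0 : ℝ),
          p.tailNLoS (p.φLoS x) * ENNReal.ofReal (x * p.fPr x * p.expLoS x))
        + ∫⁻ x in Set.Ioi (0 : ℝ),
          p.tailNLoS x * ENNReal.ofReal (x * (1 - p.fPr x) * p.expNLoS x))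

end Params

end MmWave

end

/-! Apart from the angles, a base station matters only through its link: its length and its LoS
state. By polar coordinates and independent marking, the links form a Poisson process on `ℝ × Bool`
whose intensity `Λ` has density `2πρ r f(r)` on LoS links and `2πρ r (1 - f(r))` on NLoS links
(`Network.IsModel.hasPoissonPGFL`). Give each link the score `V`, the length of the LoS link with
the same path loss. Then the serving station is the point of least score.

The law of that point follows from the generating functional alone. Differentiating it at `t = 0`
along `w = 1_C + t 1_B` gives `E[#B; C void] = e^{-Λ(C)} Λ(B)` for disjoint `B`, `C`
(`tsum_measure_void`). To let the void region `C = {V < V(y)}` depend on the point `y`, the score is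
rounded down to a grid and the mesh is sent to zero. So the best point has law `e^{-c(V(y))} Λ(dy)`,
with `c(v) = Λ(V < v)` (`sum_map_restrict_bestSet`). On the two kinds of link, `e^{-c}` is `E_L` and
`E_N`. Integrating the gain against this law gives the mean of `En1`.

For `En2` no second-order Campbell formula is needed. The points that are not best have mean measure
`(1 - e^{-c(V(y))}) Λ(dy)`. Since `c ∘ V` transports `Λ` to Lebesgue measure, `1 - e^{-c(V(y))}` is
the integral of `e^{-c(V(x))}` over `V(x) < V(y)`. Tonelli then yields the double integrals, with
`x` the serving link and `y` an interferer (`tsum_lintegral_compl_bestSet`). The angles are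
independent of the links, so the beam patterns contribute only the factor `hBar`, a product of two
mean Fejér-type kernels. Integrands are nonnegative and take values in `ℝ≥0∞`, so infinite
interference is covered without extra argument. -/

open Filter Topology

/-! ### Generating functionals and mean counts on a void event. -/

/-- `Y 0, Y 1, ...` are the points of a process with the probability generating functional of a
Poisson process of intensity `Λ`. -/
structure HasPoissonPGFL {Ω E : Type*} [MeasurableSpace Ω] [MeasurableSpace E]
    (μ : Measure Ω) (Λ : Measure E) (Y : ℕ → Ω → E) : Prop where
  measurable : ∀ k, Measurable (Y k)
  pgfl : ∀ w : E → ℝ≥0∞, Measurable w → (∀ y, w y ≤ 1) → ∫⁻ y, w y ∂Λ ≠ ∞ →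
    ∫⁻ ω, ⨅ K : ℕ, ∏ k ∈ Finset.range K, (1 - w (Y k ω)) ∂μ =
      ENNReal.ofReal (Real.exp (-(∫⁻ y, w y ∂Λ).toReal))

/-- The telescoping geometric sum in additive form, since subtraction in `ℝ≥0∞` is truncated. -/
lemma ENNReal.pow_add_mul_geom_sum {s t : ℝ≥0∞} (h : s + t = 1) (c : ℕ) :
    s ^ c + t * ∑ i ∈ Finset.range c, s ^ i = 1 := by
  induction c with
  | zero => simp
  | succ c ih =>
    rw [Finset.sum_range_succ, pow_succ]
    calc s ^ c * s + t * (∑ i ∈ Finset.range c, s ^ i + s ^ c)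
        = s ^ c * (s + t) + t * ∑ i ∈ Finset.range c, s ^ i := by ring
      _ = 1 := by rw [h, mul_one, ih]

lemma ENNReal.one_sub_pow {s t : ℝ≥0∞} (h : s + t = 1) (c : ℕ) :
    1 - s ^ c = t * ∑ i ∈ Finset.range c, s ^ i := by
  have hs : s ≤ 1 := h ▸ le_self_add
  rw [← ENNReal.pow_add_mul_geom_sum h c, ENNReal.add_sub_cancel_left]
  exact ENNReal.pow_ne_top (ne_top_of_le_ne_top ENNReal.one_ne_top hs)

lemma ENNReal.iSup_geom_sum {s : ℕ → ℝ≥0∞} (hs : Monotone s)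
    (hlim : Tendsto s atTop (𝓝 1)) (c : ℕ) :
    ⨆ m, ∑ i ∈ Finset.range c, s m ^ i = c := by
  have hmono : Monotone fun m => ∑ i ∈ Finset.range c, s m ^ i := fun a b hab =>
    Finset.sum_le_sum fun i _ => pow_le_pow_left' (hs hab) i
  refine tendsto_nhds_unique (tendsto_atTop_iSup hmono) ?_
  have : Tendsto (fun m => ∑ i ∈ Finset.range c, s m ^ i) atTop
      (𝓝 (∑ i ∈ Finset.range c, (1 : ℝ≥0∞) ^ i)) :=
    tendsto_finsetSum _ fun i _ => ((ENNReal.continuous_pow i).tendsto 1).comp hlim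
  simpa using this

/-- The derivative of `t ↦ exp (-(a + t b))` at `0`, read along `t = 1 / (m + 1)`. -/
lemma tendsto_exp_sub_exp_mul_div (a b : ℝ) :
    Tendsto (fun m : ℕ => (Real.exp (-a) - Real.exp (-(a + (1 / ((m : ℝ) + 1)) * b))) /
      (1 / ((m : ℝ) + 1))) atTop (𝓝 (Real.exp (-a) * b)) := by
  have hd : HasDerivAt (fun t : ℝ => Real.exp (-(a + t * b))) (-(Real.exp (-a) * b)) 0 := by
    have h1 : HasDerivAt (fun t : ℝ => -(a + t * b)) (-b) 0 := by
      have := (((hasDerivAt_id (0 : ℝ)).mul_const b).const_add a).fun_neg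
      rwa [one_mul] at this
    simpa using h1.exp
  have hs := hd.tendsto_slope_zero_right
  have hlim : Tendsto (fun m : ℕ => 1 / ((m : ℝ) + 1)) atTop (𝓝[>] 0) :=
    tendsto_nhdsWithin_iff.2 ⟨tendsto_one_div_add_atTop_nhds_zero_nat,
      Eventually.of_forall fun m => by simp only [Set.mem_Ioi]; positivity⟩
  have := (hs.comp hlim).neg
  rw [neg_neg] at this
  refine this.congr fun m => ?_
  simp only [Function.comp, smul_eq_mul, zero_add, zero_mul, add_zero]
  rw [div_eq_inv_mul]
  ring

-- A point in `C` makes its factor `1 - w` vanish and kills the product. If `C` is void, each point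
-- in `B` contributes a factor `s` and the others contribute `1`.
open Classical in
lemma iInf_prod_one_sub_indicator {E : Type*} {B C : Set E} {s t : ℝ≥0∞}
    (h : s + t = 1) (y : ℕ → E) :
    ⨅ K : ℕ, ∏ k ∈ Finset.range K, (1 - (C.indicator 1 (y k) + B.indicator (fun _ => t) (y k))) =
      {y : ℕ → E | ∀ j, y j ∉ C}.indicator
        (fun y => ⨅ K : ℕ, s ^ ((Finset.range K).filter fun k => y k ∈ B).card) y := by
  have ht : t ≠ ∞ := ne_top_of_le_ne_top ENNReal.one_ne_top (h ▸ le_add_self)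
  by_cases hy : ∀ j, y j ∉ C
  · rw [Set.indicator_of_mem (show y ∈ {y : ℕ → E | ∀ j, y j ∉ C} from hy)]
    refine iInf_congr fun K => ?_
    rw [← Finset.prod_const, Finset.prod_filter]
    refine Finset.prod_congr rfl fun k _ => ?_
    rw [Set.indicator_of_notMem (hy k), zero_add]
    by_cases hB : y k ∈ B
    · simp [hB, ← h, ht]
    · simp [hB]
  · rw [Set.indicator_of_notMem (show y ∉ {y : ℕ → E | ∀ j, y j ∉ C} from hy)]
    push Not at hy
    obtain ⟨j, hj⟩ := hy
    refine le_antisymm (iInf_le_of_le (j + 1) ?_) zero_le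
    rw [Finset.prod_eq_zero (Finset.self_mem_range_succ j)]
    rw [Set.indicator_of_mem hj]
    exact tsub_eq_zero_of_le le_self_add

-- The geometric sum is `(1 - s ^ c) / (1 - s)`, which increases to `c` as `s` increases to `1`. Two
-- suprema always commute, so the count may be infinite.
open Classical in
lemma iSup_iSup_geom_sum {E : Type*} {B : Set E} {s : ℕ → ℝ≥0∞} (hs : Monotone s)
    (hlim : Tendsto s atTop (𝓝 1)) (y : ℕ → E) :
    ⨆ m, ⨆ K : ℕ, ∑ i ∈ Finset.range ((Finset.range K).filter fun k => y k ∈ B).card, s m ^ i =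
      ∑' k, B.indicator 1 (y k) := by
  rw [iSup_comm, ENNReal.tsum_eq_iSup_nat]
  refine iSup_congr fun K => ?_
  rw [ENNReal.iSup_geom_sum hs hlim, Finset.card_filter]
  push_cast
  exact Finset.sum_congr rfl fun k _ => by simp [Set.indicator_apply]

namespace HasPoissonPGFL

variable {Ω E : Type*} [MeasurableSpace Ω] [MeasurableSpace E] {μ : Measure Ω} {Λ : Measure E}
  {Y : ℕ → Ω → E}

lemma measurable_iInf_prod (h : HasPoissonPGFL μ Λ Y) {w : E → ℝ≥0∞} (hw : Measurable w) :
    Measurable fun ω => ⨅ K : ℕ, ∏ k ∈ Finset.range K, (1 - w (Y k ω)) := by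
  refine Measurable.iInf fun K => Finset.measurable_fun_prod _ fun k _ => ?_
  exact measurable_const.sub (hw.comp (h.measurable k))

lemma measurableSet_void (h : HasPoissonPGFL μ Λ Y) {C : Set E} (hC : MeasurableSet C) :
    MeasurableSet {ω | ∀ j, Y j ω ∉ C} := by
  rw [Set.ofPred_forall]
  exact MeasurableSet.iInter fun j => (h.measurable j hC).compl

/-- Expected number of points in `B` on the event that `C` is void. -/
lemma tsum_measure_void [IsProbabilityMeasure μ] (h : HasPoissonPGFL μ Λ Y) {B C : Set E}
    (hB : MeasurableSet B) (hC : MeasurableSet C) (hBC : Disjoint B C) (hBt : Λ B ≠ ∞)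
    (hCt : Λ C ≠ ∞) :
    ∑' k, μ (Y k ⁻¹' B ∩ {ω | ∀ j, Y j ω ∉ C}) =
      ENNReal.ofReal (Real.exp (-(Λ C).toReal)) * Λ B := by
  classical
  set Q : Set Ω := {ω | ∀ j, Y j ω ∉ C} with hQdef
  have hQ : MeasurableSet Q := h.measurableSet_void hC
  -- The weight put on `B`; the functional is differentiated as this weight tends to `0`.
  set τ : ℕ → ℝ := fun m => 1 / ((m : ℝ) + 1) with hτ
  have hτ0 : ∀ m, 0 < τ m := fun m => by simp only [hτ]; positivity
  have hτ1 : ∀ m, τ m ≤ 1 := fun m => by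
    simp only [hτ]; rw [div_le_one (by positivity)]; linarith [(m.cast_nonneg : (0:ℝ) ≤ m)]
  set t : ℕ → ℝ≥0∞ := fun m => ENNReal.ofReal (τ m) with htdef
  set s : ℕ → ℝ≥0∞ := fun m => ENNReal.ofReal (1 - τ m) with hsdef
  have hst : ∀ m, s m + t m = 1 := fun m => by
    rw [hsdef, htdef, ← ENNReal.ofReal_add (by linarith [hτ1 m]) (hτ0 m).le]; simp
  have hτanti : Antitone τ := fun a b hab => one_div_le_one_div_of_le (by positivity) (by
    have : (a : ℝ) ≤ b := by exact_mod_cast hab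
    linarith)
  have hs : Monotone s := fun a b hab => ENNReal.ofReal_le_ofReal (by linarith [hτanti hab])
  have hslim : Tendsto s atTop (𝓝 1) := by
    have : Tendsto (fun m => 1 - τ m) atTop (𝓝 (1 - 0)) :=
      tendsto_const_nhds.sub tendsto_one_div_add_atTop_nhds_zero_nat
    simpa using ENNReal.tendsto_ofReal this
  set w : ℝ≥0∞ → E → ℝ≥0∞ := fun r y => C.indicator 1 y + B.indicator (fun _ => r) y with hw
  have hwm : ∀ r, Measurable (w r) := fun r =>
    (measurable_one.indicator hC).add (measurable_const.indicator hB)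
  have hwint : ∀ r, ∫⁻ y, w r y ∂Λ = Λ C + r * Λ B := fun r => by
    rw [lintegral_add_left (measurable_one.indicator hC), lintegral_indicator_one hC,
      lintegral_indicator_const hB]
  have hw1 : ∀ r ≤ 1, ∀ y, w r y ≤ 1 := fun r hr y => by
    by_cases hy : y ∈ C
    · have : y ∉ B := fun hyB => Set.disjoint_left.1 hBC hyB hy
      simp [hw, hy, this]
    · by_cases hyB : y ∈ B <;> simp [hw, hy, hyB, hr]
  set J : ℝ≥0∞ → Ω → ℝ≥0∞ := fun r ω =>
    ⨅ K : ℕ, ∏ k ∈ Finset.range K, (1 - w r (Y k ω)) with hJ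
  have hJm : ∀ r, Measurable (J r) := fun r => h.measurable_iInf_prod (hwm r)
  set c : ℕ → Ω → ℕ := fun K ω => ((Finset.range K).filter fun k => Y k ω ∈ B).card with hc
  have hJeq : ∀ r r', r' + r = 1 → ∀ ω, J r ω = Q.indicator (fun ω => ⨅ K, r' ^ c K ω) ω :=
    fun r r' hr ω => iInf_prod_one_sub_indicator hr fun k => Y k ω
  have hJint : ∀ r ≤ 1, ∫⁻ ω, J r ω ∂μ =
      ENNReal.ofReal (Real.exp (-((Λ C).toReal + r.toReal * (Λ B).toReal))) := fun r hr => by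
    have hr' : r ≠ ∞ := ne_top_of_le_ne_top ENNReal.one_ne_top hr
    have htop : ∫⁻ y, w r y ∂Λ ≠ ∞ := by
      rw [hwint]; exact ENNReal.add_ne_top.2 ⟨hCt, ENNReal.mul_ne_top hr' hBt⟩
    rw [hJ, h.pgfl (w r) (hwm r) (hw1 r hr) htop, hwint,
      ENNReal.toReal_add hCt (ENNReal.mul_ne_top hr' hBt), ENNReal.toReal_mul]
  -- On the void event, `S m` is the difference quotient of `J` between the weights `0` and `t m`.
  -- It increases with `m`, so monotone convergence applies. Its integral is an explicit difference
  -- quotient of exponentials.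
  set S : ℕ → Ω → ℝ≥0∞ := fun m ω => ⨆ K : ℕ, ∑ i ∈ Finset.range (c K ω), s m ^ i with hS
  have hdiff : ∀ m ω, J 0 ω - J (t m) ω = t m * Q.indicator (S m) ω := fun m ω => by
    rw [hJeq 0 1 (by simp), hJeq (t m) (s m) (hst m)]
    by_cases hω : ω ∈ Q
    · simp only [Set.indicator_of_mem hω, one_pow, iInf_const]
      rw [ENNReal.sub_iInf, hS, ENNReal.mul_iSup]
      exact iSup_congr fun K => ENNReal.one_sub_pow (hst m) _
    · simp [hω]
  have ht0 : ∀ m, t m ≠ 0 := fun m => by simpa [htdef] using hτ0 m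
  have ht1 : ∀ m, t m ≤ 1 := fun m => hst m ▸ le_add_self
  have httop : ∀ m, t m ≠ ∞ := fun m => ENNReal.ofReal_ne_top
  have hSeq : ∀ m, Q.indicator (S m) = fun ω => (t m)⁻¹ * (J 0 ω - J (t m) ω) := fun m => by
    funext ω
    rw [hdiff, ← mul_assoc, ENNReal.inv_mul_cancel (ht0 m) (httop m), one_mul]
  have hSm : ∀ m, Measurable (Q.indicator (S m)) := fun m => by
    rw [hSeq]; exact ((hJm 0).sub (hJm (t m))).const_mul _
  have hSint : ∀ m, ∫⁻ ω, Q.indicator (S m) ω ∂μ = ENNReal.ofReal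
      ((Real.exp (-(Λ C).toReal) - Real.exp (-((Λ C).toReal + τ m * (Λ B).toReal))) / τ m) :=
    fun m => by
      simp only [hSeq]
      rw [lintegral_const_mul' _ _ (ENNReal.inv_ne_top.2 (ht0 m)), lintegral_sub (hJm _),
        hJint 0 zero_le_one, hJint _ (ht1 m), ← ENNReal.ofReal_sub _ (Real.exp_pos _).le,
        htdef, ENNReal.toReal_ofReal (hτ0 m).le, ← ENNReal.ofReal_inv_of_pos (hτ0 m),
        ← ENNReal.ofReal_mul (inv_nonneg.2 (hτ0 m).le)]
      · congr 1; simp; ring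
      · rw [hJint _ (ht1 m)]; exact ENNReal.ofReal_ne_top
      · refine ae_of_all _ fun ω => ?_
        rw [hJeq 0 1 (by simp), hJeq (t m) (s m) (hst m)]
        refine Set.indicator_le_indicator ?_
        simp only [one_pow, iInf_const]
        exact iInf_le_of_le 0 (pow_le_one' (hst m ▸ le_self_add) _)
  have hmono : Monotone fun m => Q.indicator (S m) := fun a b hab ω =>
    Set.indicator_le_indicator (iSup_mono fun K => Finset.sum_le_sum fun i _ =>
      pow_le_pow_left' (hs hab) i)
  have hlim1 : ∫⁻ ω in Q, ∑' k, B.indicator 1 (Y k ω) ∂μ =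
      ⨆ m, ∫⁻ ω, Q.indicator (S m) ω ∂μ := by
    rw [← lintegral_iSup hSm hmono, ← lintegral_indicator hQ]
    refine lintegral_congr fun ω => ?_
    by_cases hω : ω ∈ Q
    · simp only [Set.indicator_of_mem hω]
      exact (iSup_iSup_geom_sum hs hslim fun k => Y k ω).symm
    · simp [hω]
  have hcount : ∑' k, μ (Y k ⁻¹' B ∩ Q) = ∫⁻ ω in Q, ∑' k, B.indicator 1 (Y k ω) ∂μ := by
    rw [lintegral_tsum (f := fun k ω => B.indicator 1 (Y k ω))
      fun k => ((measurable_one.indicator hB).comp (h.measurable k)).aemeasurable]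
    refine tsum_congr fun k => ?_
    rw [← lintegral_map (measurable_one.indicator hB) (h.measurable k), lintegral_indicator_one hB,
      Measure.map_apply (h.measurable k) hB, Measure.restrict_apply (h.measurable k hB)]
  rw [hcount, hlim1]
  refine tendsto_nhds_unique (tendsto_atTop_iSup fun a b hab => lintegral_mono (hmono hab)) ?_
  simp only [hSint]
  have := ENNReal.tendsto_ofReal (tendsto_exp_sub_exp_mul_div (Λ C).toReal (Λ B).toReal)
  rwa [ENNReal.ofReal_mul (Real.exp_pos _).le, ENNReal.ofReal_toReal hBt] at this

end HasPoissonPGFL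

/-! ### Scores and the change of variables to Lebesgue measure. -/

/-- A score of points whose sublevel sets have finite measure and whose level sets are null. -/
structure IsScore {E : Type*} [MeasurableSpace E] (Λ : Measure E) (V : E → ℝ) : Prop where
  measurable : Measurable V
  measure_lt_ne_top : ∀ v, Λ {y | V y < v} ≠ ∞
  measure_eq : ∀ v, Λ {y | V y = v} = 0
  measure_neg : Λ {y | V y < 0} = 0

/-- The measure of the set of points with score below `v`. -/
noncomputable def cumScore {E : Type*} [MeasurableSpace E] (Λ : Measure E) (V : E → ℝ) (v : ℝ) : ℝ :=
  (Λ {y | V y < v}).toReal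

namespace IsScore

variable {E : Type*} [MeasurableSpace E] {Λ : Measure E} {V : E → ℝ}

lemma measurableSet_lt (hV : IsScore Λ V) (v : ℝ) : MeasurableSet {y | V y < v} :=
  hV.measurable measurableSet_Iio

lemma iUnion_lt {E : Type*} (V : E → ℝ) : ⋃ n : ℕ, {y | V y < n} = Set.univ := by
  ext y
  simpa using exists_nat_gt (V y)

lemma ofReal_cumScore (hV : IsScore Λ V) (v : ℝ) :
    ENNReal.ofReal (cumScore Λ V v) = Λ {y | V y < v} :=
  ENNReal.ofReal_toReal (hV.measure_lt_ne_top v)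

lemma sigmaFinite (hV : IsScore Λ V) : SigmaFinite Λ :=
  ⟨⟨{ set := fun n : ℕ => {y | V y < n}
      set_mem := fun _ => trivial
      finite := fun n => (hV.measure_lt_ne_top n).lt_top
      spanning := iUnion_lt V }⟩⟩

lemma cumScore_mono (hV : IsScore Λ V) : Monotone (cumScore Λ V) := fun _ b hab =>
  ENNReal.toReal_mono (hV.measure_lt_ne_top b) (measure_mono fun _ hy => lt_of_lt_of_le hy hab)

lemma cumScore_nonneg (v : ℝ) : 0 ≤ cumScore Λ V v := ENNReal.toReal_nonneg

lemma cumScore_zero (hV : IsScore Λ V) : cumScore Λ V 0 = 0 := by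
  rw [cumScore, hV.measure_neg, ENNReal.toReal_zero]

/-- Level sets of the score are null, so the indicator of `{V < u}` converges almost everywhere as
`u` tends to `v`. It is dominated by the indicator of `{V < v + 1}`. -/
lemma cumScore_continuous (hV : IsScore Λ V) : Continuous (cumScore Λ V) := by
  have key : cumScore Λ V = fun v => ∫ y, {y | V y < v}.indicator (fun _ => (1 : ℝ)) y ∂Λ := by
    funext v
    rw [integral_indicator (hV.measurableSet_lt v)]
    simp [cumScore, Measure.real]
  rw [key, continuous_iff_continuousAt]
  intro v
  refine continuousAt_of_dominated (bound := {y | V y < v + 1}.indicator fun _ => (1 : ℝ)) ?_ ?_ ?_ ?_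
  · exact Eventually.of_forall fun u =>
      (measurable_const.indicator (hV.measurableSet_lt u)).aestronglyMeasurable
  · filter_upwards [Iio_mem_nhds (lt_add_one v)] with u hu
    refine ae_of_all _ fun y => ?_
    rw [Real.norm_of_nonneg (Set.indicator_nonneg (fun _ _ => zero_le_one) _)]
    exact Set.indicator_le_indicator_of_subset (fun y (hy : V y < u) => hy.trans hu)
      (fun _ => zero_le_one) y
  · exact (integrable_indicator_iff (hV.measurableSet_lt _)).2
      (integrableOn_const (hV.measure_lt_ne_top _))
  · have : ∀ᵐ y ∂Λ, V y ≠ v := by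
      rw [ae_iff]; simpa using hV.measure_eq v
    filter_upwards [this] with y hy
    rcases lt_or_gt_of_ne hy with h | h
    · refine (continuousAt_const (y := (1 : ℝ))).congr ?_
      filter_upwards [Ioi_mem_nhds h] with u hu
      exact (Set.indicator_of_mem (show y ∈ {y | V y < u} from hu) (fun _ => (1 : ℝ))).symm
    · refine (continuousAt_const (y := (0 : ℝ))).congr ?_
      filter_upwards [Iio_mem_nhds h] with u hu
      exact (Set.indicator_of_notMem (show y ∉ {y | V y < u} from fun h' : V y < u => lt_asymm h' hu)
        (fun _ => (1 : ℝ))).symm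

/-- By the intermediate value theorem `s` is attained as the measure of some sublevel set `{V < u}`,
which lies in the set considered. -/
lemma measure_cumScore_le (hV : IsScore Λ V) {v s : ℝ} (hs : 0 ≤ s) (hsv : s < cumScore Λ V v) :
    Λ {y | cumScore Λ V (V y) ≤ s ∧ V y < v} = ENNReal.ofReal s := by
  have hv : 0 ≤ v := by
    by_contra hv
    have := hV.cumScore_mono (le_of_lt (not_le.1 hv))
    rw [hV.cumScore_zero] at this
    linarith
  have ivt : ∀ r, 0 ≤ r → r ≤ cumScore Λ V v → ∃ u ≤ v, cumScore Λ V u = r := fun r h0 h1 => by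
    obtain ⟨u, hu, hur⟩ := intermediate_value_Icc hv hV.cumScore_continuous.continuousOn
      (show r ∈ Set.Icc (cumScore Λ V 0) (cumScore Λ V v) by rw [hV.cumScore_zero]; exact ⟨h0, h1⟩)
    exact ⟨u, hu.2, hur⟩
  refine le_antisymm ?_ ?_
  -- The cumulative score may be flat at height `s`, so the upper bound uses a level where it
  -- slightly exceeds `s`. The minimum keeps that height in the attained range.
  · refine ENNReal.le_of_forall_pos_le_add fun ε hε _ => ?_
    set r := min (s + ε) (cumScore Λ V v) with hr
    have hsr : s < r := lt_min (by have : (0 : ℝ) < ε := hε; linarith) hsv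
    obtain ⟨u, -, hu⟩ := ivt r (hs.trans hsr.le) (min_le_right _ _)
    calc Λ {y | cumScore Λ V (V y) ≤ s ∧ V y < v} ≤ Λ {y | V y < u} := by
          refine measure_mono fun y hy => ?_
          by_contra hlt
          have := hV.cumScore_mono (not_lt.1 hlt)
          have := hy.1
          linarith
      _ = ENNReal.ofReal r := by rw [← hV.ofReal_cumScore, hu]
      _ ≤ ENNReal.ofReal (s + ε) := ENNReal.ofReal_le_ofReal (min_le_left _ _)
      _ = ENNReal.ofReal s + ε := by
          rw [ENNReal.ofReal_add hs ε.coe_nonneg, ENNReal.ofReal_coe_nnreal]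
  · obtain ⟨u, huv, hu⟩ := ivt s hs hsv.le
    rw [← hu, hV.ofReal_cumScore]
    refine measure_mono fun y (hy : V y < u) => ⟨?_, hy.trans_le huv⟩
    exact hV.cumScore_mono hy.le

/-- The cumulative score transports the measure below a level to Lebesgue measure. -/
lemma map_cumScore (hV : IsScore Λ V) (v : ℝ) :
    (Λ.restrict {y | V y < v}).map (fun y => cumScore Λ V (V y)) =
      volume.restrict (Set.Icc 0 (cumScore Λ V v)) := by
  have hm : Measurable fun y => cumScore Λ V (V y) :=
    hV.cumScore_continuous.measurable.comp hV.measurable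
  have : IsFiniteMeasure (Λ.restrict {y | V y < v}) :=
    ⟨by rw [Measure.restrict_apply_univ]; exact (hV.measure_lt_ne_top v).lt_top⟩
  refine Measure.ext_of_Iic _ _ fun s => ?_
  rw [Measure.map_apply hm measurableSet_Iic, Measure.restrict_apply (hm measurableSet_Iic),
    Measure.restrict_apply measurableSet_Iic]
  change Λ {y | cumScore Λ V (V y) ≤ s ∧ V y < v} = _
  rcases lt_or_ge s 0 with hs | hs
  · have h1 : {y | cumScore Λ V (V y) ≤ s ∧ V y < v} = ∅ :=
      Set.eq_empty_of_forall_notMem fun y hy =>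
        absurd (cumScore_nonneg (Λ := Λ) (V := V) (V y)) (by have := hy.1; linarith)
    have h2 : Set.Iic s ∩ Set.Icc 0 (cumScore Λ V v) = ∅ :=
      Set.eq_empty_of_forall_notMem fun y hy => absurd hy.2.1 (by have := hy.1.out; linarith)
    rw [h1, h2, measure_empty, measure_empty]
  · rcases lt_or_ge s (cumScore Λ V v) with hsv | hsv
    · have : Set.Iic s ∩ Set.Icc 0 (cumScore Λ V v) = Set.Icc 0 s := by
        ext x; simp only [Set.mem_inter_iff, Set.mem_Iic, Set.mem_Icc]
        constructor
        · rintro ⟨a, b, c⟩; exact ⟨b, a⟩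
        · rintro ⟨a, b⟩; exact ⟨b, a, by linarith⟩
      rw [this, hV.measure_cumScore_le hs hsv, Real.volume_Icc, sub_zero]
    · have : Set.Iic s ∩ Set.Icc 0 (cumScore Λ V v) = Set.Icc 0 (cumScore Λ V v) :=
        Set.inter_eq_right.2 fun x hx => hx.2.trans hsv
      rw [this, Real.volume_Icc, sub_zero, hV.ofReal_cumScore]
      congr 1
      ext y
      exact ⟨fun hy => hy.2, fun hy => ⟨(hV.cumScore_mono (le_of_lt hy)).trans hsv, hy⟩⟩

/-- The probability that the best point of the process has a score as good as that of `y`. -/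
noncomputable def voidProb (Λ : Measure E) (V : E → ℝ) (y : E) : ℝ≥0∞ :=
  ENNReal.ofReal (Real.exp (-cumScore Λ V (V y)))

lemma measurable_voidProb (hV : IsScore Λ V) : Measurable (voidProb Λ V) :=
  (Real.measurable_exp.comp
    (hV.cumScore_continuous.measurable.comp hV.measurable).neg).ennreal_ofReal

lemma voidProb_le_one (y : E) : voidProb Λ V y ≤ 1 := by
  rw [voidProb, ENNReal.ofReal_le_one, Real.exp_le_one_iff]
  linarith [cumScore_nonneg (Λ := Λ) (V := V) (V y)]

/-- In the variable `x = cumScore Λ V (V y)` this is the integral of `e^{-x}` from `0` to `cumScore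
Λ V v`. -/
lemma setLIntegral_voidProb (hV : IsScore Λ V) (v : ℝ) :
    ∫⁻ y in {y | V y < v}, voidProb Λ V y ∂Λ =
      1 - ENNReal.ofReal (Real.exp (-cumScore Λ V v)) := by
  have hm : Measurable fun y => cumScore Λ V (V y) :=
    hV.cumScore_continuous.measurable.comp hV.measurable
  have hg : Measurable fun x : ℝ => ENNReal.ofReal (Real.exp (-x)) :=
    (Real.measurable_exp.comp measurable_neg).ennreal_ofReal
  have h0 : 0 ≤ cumScore Λ V v := cumScore_nonneg v
  have hi : IntervalIntegrable (fun x => Real.exp (-x)) volume 0 (cumScore Λ V v) :=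
    (Real.continuous_exp.comp continuous_neg).intervalIntegrable _ _
  calc ∫⁻ y in {y | V y < v}, voidProb Λ V y ∂Λ
      = ∫⁻ x in Set.Icc 0 (cumScore Λ V v), ENNReal.ofReal (Real.exp (-x)) := by
        rw [← hV.map_cumScore v, lintegral_map hg hm]; rfl
    _ = ENNReal.ofReal (∫ x in (0 : ℝ)..cumScore Λ V v, Real.exp (-x)) := by
        rw [intervalIntegral.integral_of_le h0, setLIntegral_congr Ioc_ae_eq_Icc.symm,
          ofReal_integral_eq_lintegral_ofReal hi.1 (ae_of_all _ fun x => (Real.exp_pos _).le)]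
    _ = _ := by
        rw [intervalIntegral.integral_comp_neg (fun x => Real.exp x), integral_exp, neg_zero,
          Real.exp_zero, ENNReal.ofReal_sub _ (Real.exp_pos _).le, ENNReal.ofReal_one]

/-- Let the level in `setLIntegral_voidProb` tend to infinity. The bound will limit the expected
number of best points to one and make the serving densities integrable. -/
lemma lintegral_voidProb_le (hV : IsScore Λ V) : ∫⁻ y, voidProb Λ V y ∂Λ ≤ 1 := by
  have hmono : Monotone fun n : ℕ => {y | V y < n} := fun a b hab y hy =>
    lt_of_lt_of_le (show V y < a from hy) (Nat.cast_le.2 hab)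
  rw [← setLIntegral_univ, ← withDensity_apply _ MeasurableSet.univ, ← iUnion_lt V,
    hmono.measure_iUnion]
  refine iSup_le fun n => ?_
  rw [withDensity_apply _ (hV.measurableSet_lt n), hV.setLIntegral_voidProb]
  exact tsub_le_self

/-- Sublevel sets of the score have finite `Λ`-measure and exhaust the space, so testing on sets of
finite `Λ`-measure suffices. -/
lemma ext_of_finite (hV : IsScore Λ V) {m₁ m₂ : Measure E}
    (h : ∀ B, MeasurableSet B → Λ B ≠ ∞ → m₁ B = m₂ B) : m₁ = m₂ := by
  refine (Measure.ext_iff_of_iUnion_eq_univ (iUnion_lt V)).2 fun n => Measure.ext fun s hs => ?_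
  rw [Measure.restrict_apply hs, Measure.restrict_apply hs]
  exact h _ (hs.inter (hV.measurableSet_lt n))
    (measure_ne_top_of_subset Set.inter_subset_right (hV.measure_lt_ne_top n))

end IsScore

/-! ### The law of the best point and of the remaining points. -/

/-- Rounding down to the multiples of `1 / (n + 1)`. -/
noncomputable def roundDown (n : ℕ) (v : ℝ) : ℝ := ⌊((n : ℝ) + 1) * v⌋ / ((n : ℝ) + 1)

lemma roundDown_le (n : ℕ) (v : ℝ) : roundDown n v ≤ v := by
  rw [roundDown, div_le_iff₀ (by positivity), mul_comm]
  exact Int.floor_le _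

lemma tendsto_roundDown (v : ℝ) : Tendsto (fun n => roundDown n v) atTop (𝓝 v) := by
  have h : Tendsto (fun n : ℕ => v - 1 / ((n : ℝ) + 1)) atTop (𝓝 (v - 0)) :=
    tendsto_const_nhds.sub tendsto_one_div_add_atTop_nhds_zero_nat
  rw [sub_zero] at h
  refine tendsto_of_tendsto_of_tendsto_of_le_of_le h tendsto_const_nhds (fun n => ?_)
    fun n => roundDown_le n v
  have hn : (0 : ℝ) < (n : ℝ) + 1 := by positivity
  simp only [roundDown]
  rw [le_div_iff₀ hn, sub_mul, one_div_mul_cancel hn.ne', mul_comm]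
  exact (Int.sub_one_lt_floor _).le

lemma measurable_roundDown (n : ℕ) : Measurable (roundDown n) :=
  ((measurable_from_top (f := fun z : ℤ => (z : ℝ))).comp
    (Int.measurable_floor.comp (measurable_id.const_mul _))).div_const _

namespace HasPoissonPGFL

variable {Ω E : Type*} [MeasurableSpace Ω] [MeasurableSpace E] {μ : Measure Ω} {Λ : Measure E}
  {Y : ℕ → Ω → E} {V : E → ℝ}

lemma tsum_measure_preimage [IsProbabilityMeasure μ] (h : HasPoissonPGFL μ Λ Y) {B : Set E}
    (hB : MeasurableSet B) (hBt : Λ B ≠ ∞) : ∑' k, μ (Y k ⁻¹' B) = Λ B := by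
  simpa using h.tsum_measure_void hB MeasurableSet.empty (Set.disjoint_empty B) hBt (by simp)

/-- Campbell's formula. -/
lemma sum_map [IsProbabilityMeasure μ] (h : HasPoissonPGFL μ Λ Y) (hV : IsScore Λ V) :
    Measure.sum (fun k => μ.map (Y k)) = Λ := by
  refine hV.ext_of_finite fun B hB hBt => ?_
  rw [Measure.sum_apply _ hB]
  simp only [Measure.map_apply (h.measurable _) hB]
  exact h.tsum_measure_preimage hB hBt

/-- The event that no point of the process is strictly better than the `k`-th one. -/
def bestSet (Y : ℕ → Ω → E) (V : E → ℝ) (k : ℕ) : Set Ω := {ω | ∀ j, V (Y k ω) ≤ V (Y j ω)}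

lemma measurableSet_bestSet (h : HasPoissonPGFL μ Λ Y) (hV : IsScore Λ V) (k : ℕ) :
    MeasurableSet (bestSet Y V k) := by
  rw [bestSet, Set.ofPred_forall]
  exact MeasurableSet.iInter fun j =>
    measurableSet_le (hV.measurable.comp (h.measurable k)) (hV.measurable.comp (h.measurable j))

lemma measurableSet_roundedBest (h : HasPoissonPGFL μ Λ Y) (hV : IsScore Λ V) (n k : ℕ) :
    MeasurableSet {ω | ∀ j, roundDown n (V (Y k ω)) ≤ V (Y j ω)} := by
  rw [Set.ofPred_forall]
  exact MeasurableSet.iInter fun j =>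
    measurableSet_le ((measurable_roundDown n).comp (hV.measurable.comp (h.measurable k)))
      (hV.measurable.comp (h.measurable j))

/-- On the slab where the rounded score is `z / (n + 1)`, the threshold is a constant. The event
then says that the fixed set `C z` is void, so `tsum_measure_void` applies slab by slab. -/
lemma tsum_measure_roundedBest [IsProbabilityMeasure μ] (h : HasPoissonPGFL μ Λ Y)
    (hV : IsScore Λ V) {B : Set E} (hB : MeasurableSet B) (hBt : Λ B ≠ ∞) (n : ℕ) :
    ∑' k, μ (Y k ⁻¹' B ∩ {ω | ∀ j, roundDown n (V (Y k ω)) ≤ V (Y j ω)}) =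
      ∫⁻ y in B, ENNReal.ofReal (Real.exp (-cumScore Λ V (roundDown n (V y)))) ∂Λ := by
  have hn : (0 : ℝ) < (n : ℝ) + 1 := by positivity
  set T : ℤ → Set E := fun z => {y | ⌊((n : ℝ) + 1) * V y⌋ = z} with hT
  have hTm : ∀ z, MeasurableSet (T z) := fun z =>
    (Int.measurable_floor.comp (hV.measurable.const_mul _)) (measurableSet_singleton z)
  set C : ℤ → Set E := fun z => {y | V y < z / ((n : ℝ) + 1)} with hC
  have hround : ∀ z, ∀ y ∈ T z, roundDown n (V y) = z / ((n : ℝ) + 1) := fun z y hy => by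
    rw [roundDown, show ⌊((n : ℝ) + 1) * V y⌋ = z from hy]
  have hdisj : Pairwise fun z z' => Disjoint (T z) (T z') := fun z z' hzz' =>
    Set.disjoint_left.2 fun y hy hy' => hzz' (hy.symm.trans hy')
  -- Rounding down, rather than to the nearest multiple, is what keeps a slab out of its own void
  -- region.
  have hTC : ∀ z, Disjoint (B ∩ T z) (C z) := fun z => Set.disjoint_left.2 fun y hy hy' => by
    have := roundDown_le n (V y)
    rw [hround z y hy.2] at this
    exact absurd hy' (not_lt.2 this)
  have hcover : ⋃ z, B ∩ T z = B := by
    rw [← Set.inter_iUnion, Set.inter_eq_left]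
    exact fun y _ => Set.mem_iUnion.2 ⟨_, rfl⟩
  have hleft : ∀ k, μ (Y k ⁻¹' B ∩ {ω | ∀ j, roundDown n (V (Y k ω)) ≤ V (Y j ω)}) =
      ∑' z, μ (Y k ⁻¹' (B ∩ T z) ∩ {ω | ∀ j, Y j ω ∉ C z}) := fun k => by
    rw [← measure_iUnion]
    · congr 1
      ext ω
      simp only [Set.mem_inter_iff, Set.mem_preimage, Set.mem_iUnion]
      constructor
      · rintro ⟨h1, h2⟩
        refine ⟨_, ⟨h1, rfl⟩, fun j hj => absurd (h2 j) (not_le.2 ?_)⟩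
        exact hj
      · rintro ⟨z, ⟨h1, h2⟩, h3⟩
        refine ⟨h1, fun j => ?_⟩
        rw [hround z _ h2]
        exact not_lt.1 (h3 j)
    · intro z z' hzz'
      refine Set.disjoint_left.2 fun ω hω hω' => ?_
      exact Set.disjoint_left.1 (hdisj hzz') hω.1.2 hω'.1.2
    · exact fun z => (h.measurable k (hB.inter (hTm z))).inter
        (h.measurableSet_void (hV.measurableSet_lt _))
  have hright : ∫⁻ y in B, ENNReal.ofReal (Real.exp (-cumScore Λ V (roundDown n (V y)))) ∂Λ =
      ∑' z, ENNReal.ofReal (Real.exp (-(Λ (C z)).toReal)) * Λ (B ∩ T z) := by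
    rw [← hcover, lintegral_iUnion (fun z => hB.inter (hTm z))
      (fun z z' hzz' => ((hdisj hzz').inter_left' B).inter_right' B), hcover]
    refine tsum_congr fun z => ?_
    rw [setLIntegral_congr_fun (hB.inter (hTm z))
      (g := fun _ => ENNReal.ofReal (Real.exp (-(Λ (C z)).toReal))) fun y hy => by
        simp only [hround z y hy.2]; rfl, setLIntegral_const]
  rw [hright, tsum_congr hleft, ENNReal.tsum_comm]
  refine tsum_congr fun z => ?_
  exact h.tsum_measure_void (hB.inter (hTm z)) (hV.measurableSet_lt _) (hTC z)
    (measure_ne_top_of_subset Set.inter_subset_left hBt) (hV.measure_lt_ne_top _)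

/-- The law of the best points of the process. -/
lemma sum_map_restrict_bestSet [IsProbabilityMeasure μ] (h : HasPoissonPGFL μ Λ Y)
    (hV : IsScore Λ V) :
    Measure.sum (fun k => (μ.restrict (bestSet Y V k)).map (Y k)) =
      Λ.withDensity (IsScore.voidProb Λ V) := by
  refine hV.ext_of_finite fun B hB hBt => ?_
  rw [Measure.sum_apply _ hB, withDensity_apply _ hB]
  simp only [Measure.map_apply (h.measurable _) hB,
    Measure.restrict_apply (h.measurable _ hB)]
  have hround : ∀ n, Measurable fun y : E => roundDown n (V y) := fun n =>
    (measurable_roundDown n).comp hV.measurable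
  -- The grids are not nested, so convergence is dominated rather than monotone: `μ (Y k ⁻¹' B)`
  -- sums to `Λ B`. For fixed `ω` and `k` the event stabilises, because a strictly better point is
  -- eventually below the rounded threshold.
  have h1 : Tendsto (fun n : ℕ =>
      ∑' k, μ (Y k ⁻¹' B ∩ {ω | ∀ j, roundDown n (V (Y k ω)) ≤ V (Y j ω)})) atTop
      (𝓝 (∑' k, μ (Y k ⁻¹' B ∩ bestSet Y V k))) := by
    simp only [← lintegral_count]
    refine tendsto_lintegral_of_dominated_convergence (fun k => μ (Y k ⁻¹' B))
      (fun _ => measurable_of_countable _)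
      (fun n => ae_of_all _ fun k => measure_mono Set.inter_subset_left) ?_ ?_
    · rw [lintegral_count, h.tsum_measure_preimage hB hBt]
      exact hBt
    · refine ae_of_all _ fun k => ?_
      refine tendsto_measure_of_tendsto_indicator atTop (B := Set.univ)
        (fun n => (h.measurable k hB).inter (h.measurableSet_roundedBest hV n k))
        MeasurableSet.univ (measure_ne_top _ _) (Eventually.of_forall fun _ => Set.subset_univ _)
        fun ω => ?_
      by_cases hω : ∀ j, V (Y k ω) ≤ V (Y j ω)
      · refine Eventually.of_forall fun n => and_congr_right fun _ => ?_
        exact ⟨fun _ => hω, fun _ j => (roundDown_le _ _).trans (hω j)⟩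
      · have hω' := hω
        push Not at hω'
        obtain ⟨j, hj⟩ := hω'
        filter_upwards [(tendsto_roundDown (V (Y k ω))).eventually (lt_mem_nhds hj)] with n hn
        exact and_congr_right fun _ => ⟨fun hall => absurd (hall j) (not_le.2 hn),
          fun hall => absurd hall hω⟩
  have h2 : Tendsto (fun n : ℕ =>
      ∫⁻ y in B, ENNReal.ofReal (Real.exp (-cumScore Λ V (roundDown n (V y)))) ∂Λ) atTop
      (𝓝 (∫⁻ y in B, IsScore.voidProb Λ V y ∂Λ)) := by
    refine tendsto_lintegral_of_dominated_convergence (fun _ => 1) (fun n => ?_) (fun n => ?_) ?_ ?_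
    · exact (Real.measurable_exp.comp
        (hV.cumScore_continuous.measurable.comp (hround n)).neg).ennreal_ofReal
    · refine ae_of_all _ fun y => ?_
      rw [ENNReal.ofReal_le_one, Real.exp_le_one_iff]
      linarith [IsScore.cumScore_nonneg (Λ := Λ) (V := V) (roundDown n (V y))]
    · simpa using hBt
    · refine ae_of_all _ fun y => ?_
      have hc : Continuous fun v => ENNReal.ofReal (Real.exp (-cumScore Λ V v)) :=
        ENNReal.continuous_ofReal.comp (Real.continuous_exp.comp hV.cumScore_continuous.neg)
      exact (hc.tendsto _).comp (tendsto_roundDown (V y))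
  refine tendsto_nhds_unique h1 (h2.congr fun n => ?_)
  exact (h.tsum_measure_roundedBest hV hB hBt n).symm

lemma tsum_lintegral_bestSet [IsProbabilityMeasure μ] (h : HasPoissonPGFL μ Λ Y)
    (hV : IsScore Λ V) {g : E → ℝ≥0∞} (hg : Measurable g) :
    ∑' k, ∫⁻ ω in bestSet Y V k, g (Y k ω) ∂μ = ∫⁻ y, g y * IsScore.voidProb Λ V y ∂Λ := by
  have := congrArg (fun m => ∫⁻ y, g y ∂m) (h.sum_map_restrict_bestSet hV)
  simp only [lintegral_sum_measure, lintegral_map hg (h.measurable _)] at this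
  rw [this, lintegral_withDensity_eq_lintegral_mul _ hV.measurable_voidProb hg]
  exact lintegral_congr fun y => mul_comm _ _

/-- The law of the points of the process that are not best. -/
lemma sum_map_restrict_compl_bestSet [IsProbabilityMeasure μ] (h : HasPoissonPGFL μ Λ Y)
    (hV : IsScore Λ V) :
    Measure.sum (fun k => (μ.restrict (bestSet Y V k)ᶜ).map (Y k)) =
      Λ.withDensity (fun y => 1 - IsScore.voidProb Λ V y) := by
  have hsum : Measure.sum (fun k => (μ.restrict (bestSet Y V k)).map (Y k)) +
      Measure.sum (fun k => (μ.restrict (bestSet Y V k)ᶜ).map (Y k)) = Λ := by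
    rw [Measure.sum_add_sum, ← h.sum_map hV]
    congr 1
    funext k
    rw [← Measure.map_add _ _ (h.measurable k),
      Measure.restrict_add_restrict_compl (h.measurableSet_bestSet hV k)]
  have hdens : Λ.withDensity (IsScore.voidProb Λ V) +
      Λ.withDensity (fun y => 1 - IsScore.voidProb Λ V y) = Λ := by
    rw [← withDensity_add_left hV.measurable_voidProb]
    conv_rhs => rw [← withDensity_one (μ := Λ)]
    congr 1
    funext y
    exact add_tsub_cancel_of_le (IsScore.voidProb_le_one y)
  -- The common summand can be cancelled only where it is finite, hence the test sets of finite
  -- `Λ`-measure.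
  refine hV.ext_of_finite fun B hB hBt => ?_
  have h1 := congrArg (fun m => m B) (hsum.trans hdens.symm)
  simp only [Measure.add_apply] at h1
  rw [h.sum_map_restrict_bestSet hV] at h1
  refine (ENNReal.add_right_inj ?_).1 h1
  refine ne_top_of_le_ne_top hBt ?_
  conv_rhs => rw [← hdens]
  exact le_self_add

/-- The density `1 - voidProb` at `y` is itself the integral of `voidProb` over the `x` scoring
below `y`. Tonelli exchanges the two integrals, and `x` takes the role of the best point. -/
lemma tsum_lintegral_compl_bestSet [IsProbabilityMeasure μ] (h : HasPoissonPGFL μ Λ Y)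
    (hV : IsScore Λ V) {g : E → ℝ≥0∞} (hg : Measurable g) :
    ∑' k, ∫⁻ ω in (bestSet Y V k)ᶜ, g (Y k ω) ∂μ =
      ∫⁻ x, IsScore.voidProb Λ V x * ∫⁻ y in {y | V x < V y}, g y ∂Λ ∂Λ := by
  have := hV.sigmaFinite
  have h1 := congrArg (fun m => ∫⁻ y, g y ∂m) (h.sum_map_restrict_compl_bestSet hV)
  simp only [lintegral_sum_measure, lintegral_map hg (h.measurable _)] at h1
  rw [h1, lintegral_withDensity_eq_lintegral_mul _ (hV.measurable_voidProb.const_sub 1) hg]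
  have hlt : MeasurableSet {q : E × E | V q.1 < V q.2} :=
    measurableSet_lt (hV.measurable.comp measurable_fst) (hV.measurable.comp measurable_snd)
  calc ∫⁻ y, ((fun y => 1 - IsScore.voidProb Λ V y) * g) y ∂Λ
      = ∫⁻ y, ∫⁻ x, {q : E × E | V q.1 < V q.2}.indicator
          (fun q => IsScore.voidProb Λ V q.1 * g q.2) (x, y) ∂Λ ∂Λ := by
        refine lintegral_congr fun y => ?_
        have : ∀ x, {q : E × E | V q.1 < V q.2}.indicator
            (fun q => IsScore.voidProb Λ V q.1 * g q.2) (x, y) =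
            {x | V x < V y}.indicator (IsScore.voidProb Λ V) x * g y := fun x => by
          by_cases hx : V x < V y <;> simp [hx]
        simp only [this, Pi.mul_apply]
        rw [lintegral_mul_const _ (hV.measurable_voidProb.indicator (hV.measurableSet_lt _)),
          lintegral_indicator (hV.measurableSet_lt _), hV.setLIntegral_voidProb]
        rfl
    _ = ∫⁻ x, ∫⁻ y, {q : E × E | V q.1 < V q.2}.indicator
          (fun q => IsScore.voidProb Λ V q.1 * g q.2) (x, y) ∂Λ ∂Λ := by
        refine lintegral_lintegral_swap (Measurable.aemeasurable ?_)
        exact (((hV.measurable_voidProb.comp measurable_fst).mul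
          (hg.comp measurable_snd)).indicator hlt).comp measurable_swap
    _ = _ := by
        refine lintegral_congr fun x => ?_
        have hx : MeasurableSet {y | V x < V y} := hV.measurable measurableSet_Ioi
        rw [← lintegral_indicator hx, ← lintegral_const_mul _ (hg.indicator hx)]
        refine lintegral_congr fun y => ?_
        by_cases hxy : V x < V y <;> simp [hxy]

/-- Almost surely exactly one point of the process is best. -/
lemma ae_existsUnique_best [IsProbabilityMeasure μ] (h : HasPoissonPGFL μ Λ Y)
    (hV : IsScore Λ V) : ∀ᵐ ω ∂μ, ∃! k, ω ∈ bestSet Y V k := by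
  -- Borel–Cantelli: only finitely many points score below any given level, so a minimum is
  -- attained.
  have hfin : ∀ᵐ ω ∂μ, ∀ n : ℕ, {k | V (Y k ω) < n}.Finite := by
    rw [ae_all_iff]
    intro n
    have := measure_setOfPred_frequently_eq_zero (μ := μ) (p := fun k ω => V (Y k ω) < n) (by
      have := h.tsum_measure_preimage (hV.measurableSet_lt n) (hV.measure_lt_ne_top n)
      exact (this.trans_lt (hV.measure_lt_ne_top n).lt_top).ne)
    have hae : ∀ᵐ ω ∂μ, ¬ ∃ᶠ k in atTop, V (Y k ω) < n := by
      rw [ae_iff]; simpa only [not_not] using this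
    filter_upwards [hae] with ω hω
    rw [Nat.frequently_atTop_iff_infinite] at hω
    exact Set.not_infinite.1 hω
  have hex : ∀ᵐ ω ∂μ, ∃ k, ω ∈ bestSet Y V k := by
    filter_upwards [hfin] with ω hω
    obtain ⟨n, hn⟩ := exists_nat_gt (V (Y 0 ω))
    obtain ⟨k, hk, hmin⟩ := Set.exists_min_image _ (fun k => V (Y k ω)) (hω n) ⟨0, hn⟩
    refine ⟨k, fun j => ?_⟩
    rcases lt_or_ge (V (Y j ω)) n with hj | hj
    · exact hmin j hj
    · exact (le_of_lt hk).trans hj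
  -- The number of best points is almost surely at least one and has mean at most one, so it is
  -- almost surely one. This excludes ties.
  have hcount : ∫⁻ ω, ∑' k, (bestSet Y V k).indicator 1 ω ∂μ ≤ 1 := by
    rw [lintegral_tsum fun k =>
      (measurable_one.indicator (h.measurableSet_bestSet hV k)).aemeasurable]
    have := h.tsum_lintegral_bestSet hV (measurable_one (α := ℝ≥0∞))
    simp only [Pi.one_apply, one_mul, setLIntegral_one] at this
    simp only [lintegral_indicator_one (h.measurableSet_bestSet hV _)]
    rw [this]
    exact hV.lintegral_voidProb_le
  have hge : ∀ᵐ ω ∂μ, (1 : ℝ≥0∞) ≤ ∑' k, (bestSet Y V k).indicator 1 ω := by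
    filter_upwards [hex] with ω ⟨k, hk⟩
    refine le_trans ?_ (ENNReal.le_tsum k)
    simp [hk]
  have hmeas : Measurable fun ω => ∑' k, (bestSet Y V k).indicator (1 : Ω → ℝ≥0∞) ω :=
    Measurable.tsum fun k => measurable_one.indicator (h.measurableSet_bestSet hV k)
  have heq : (fun _ => (1 : ℝ≥0∞)) =ᵐ[μ] fun ω => ∑' k, (bestSet Y V k).indicator 1 ω :=
    ae_eq_of_ae_le_of_lintegral_le hge (by simp) hmeas.aemeasurable (by simpa using hcount)
  filter_upwards [hex, heq] with ω ⟨k, hk⟩ hω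
  refine ⟨k, hk, fun j hj => ?_⟩
  by_contra hjk
  have h2 : ∑ i ∈ ({j, k} : Finset ℕ), (bestSet Y V i).indicator (1 : Ω → ℝ≥0∞) ω ≤ 1 := by
    rw [hω]; exact ENNReal.sum_le_tsum _
  rw [Finset.sum_pair hjk, Set.indicator_of_mem hj, Set.indicator_of_mem hk] at h2
  norm_num at h2

end HasPoissonPGFL

/-! ### The generating functional of a homogeneous Poisson process. -/

lemma hasSum_poisson_mul_pow (m s : ℝ) :
    HasSum (fun n : ℕ => s ^ n * (Real.exp (-m) * m ^ n / (n.factorial : ℝ)))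
      (Real.exp (-(m * (1 - s)))) := by
  have h := (NormedSpace.expSeries_div_hasSum_exp (m * s)).mul_left (Real.exp (-m))
  rw [← Real.exp_eq_exp_ℝ, ← Real.exp_add] at h
  have he : -m + m * s = -(m * (1 - s)) := by ring
  rw [he] at h
  refine h.congr_fun fun n => ?_
  rw [mul_pow]
  ring

lemma ENNReal.tsum_indicator_one_eq_encard (s : Set ℕ) :
    ∑' k, s.indicator (1 : ℕ → ℝ≥0∞) k = s.encard := by
  rw [← tsum_subtype]
  exact ENNReal.tsum_set_one s

namespace MmWave.IsHomogeneousPPP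

variable {Ω : Type*} [MeasurableSpace Ω] {μ : Measure Ω} {ρ : ℝ} {X : ℕ → Ω → Plane}

lemma measurable_pointCount (h : IsHomogeneousPPP μ ρ X) {B : Set Plane} (hB : MeasurableSet B) :
    Measurable fun ω => pointCount (fun k => X k ω) B := by
  refine measurable_to_countable' fun x => ?_
  have : (fun ω => pointCount (fun k => X k ω) B) ⁻¹' {x} =
      {ω | ∑' k, B.indicator (1 : Plane → ℝ≥0∞) (X k ω) = x} := by
    ext ω
    have := ENNReal.tsum_indicator_one_eq_encard {k | X k ω ∈ B}
    have h2 : ∑' k, B.indicator (1 : Plane → ℝ≥0∞) (X k ω) =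
        ({k | X k ω ∈ B}.encard : ℝ≥0∞) := by
      rw [← this]
      exact tsum_congr fun k => by by_cases hk : X k ω ∈ B <;> simp [hk]
    rw [Set.mem_preimage, Set.mem_singleton_iff, Set.mem_ofPred_eq, h2, ENat.toENNReal_inj]
    rfl
  rw [this]
  exact (Measurable.tsum fun k => (measurable_one.indicator hB).comp (h.measurable k))
    (measurableSet_singleton _)

/-- The Poisson weights of the finite values already sum to one, which leaves no mass for `⊤`. -/
lemma ae_pointCount_ne_top [IsProbabilityMeasure μ] (h : IsHomogeneousPPP μ ρ X) (hρ : 0 ≤ ρ)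
    {B : Set Plane} (hB : MeasurableSet B) (hBt : volume B ≠ ∞) :
    ∀ᵐ ω ∂μ, pointCount (fun k => X k ω) B ≠ ⊤ := by
  have hm : 0 ≤ ρ * (volume B).toReal := mul_nonneg hρ ENNReal.toReal_nonneg
  have hmeas : ∀ n : ℕ, MeasurableSet {ω | pointCount (fun k => X k ω) B = n} := fun n =>
    h.measurable_pointCount hB (measurableSet_singleton (n : ℕ∞))
  have hone : μ (⋃ n : ℕ, {ω | pointCount (fun k => X k ω) B = n}) = 1 := by
    rw [measure_iUnion _ hmeas]
    · simp only [h.poisson B hB hBt]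
      have hs := hasSum_poisson_mul_pow (ρ * (volume B).toReal) 1
      simp only [one_pow, one_mul, sub_self, mul_zero, neg_zero, Real.exp_zero] at hs
      rw [← ENNReal.ofReal_tsum_of_nonneg _ hs.summable, hs.tsum_eq, ENNReal.ofReal_one]
      intro n
      positivity
    · intro a b hab
      refine Set.disjoint_left.2 fun ω h1 h2 => hab ?_
      exact_mod_cast (show pointCount (fun k => X k ω) B = a from h1).symm.trans h2
  have hae := (prob_compl_eq_zero_iff (MeasurableSet.iUnion hmeas)).2 hone
  rw [ae_iff]
  refine measure_mono_null (fun ω hω => ?_) hae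
  simp only [Set.mem_compl_iff, Set.mem_iUnion, not_exists]
  intro n hn
  have h1 : pointCount (fun k => X k ω) B = n := hn
  have h2 : pointCount (fun k => X k ω) B = ⊤ := not_not.1 hω
  rw [h2] at h1
  exact absurd h1 (ENat.top_ne_natCast n)

/-- Probability generating function of the number of points in a set. -/
lemma lintegral_pow_pointCount [IsProbabilityMeasure μ] (h : IsHomogeneousPPP μ ρ X) (hρ : 0 ≤ ρ)
    {B : Set Plane} (hB : MeasurableSet B) (hBt : volume B ≠ ∞) {x : ℝ≥0∞} (hx : x ≤ 1) :
    ∫⁻ ω, (1 - x) ^ (pointCount (fun k => X k ω) B).toNat ∂μ =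
      ENNReal.ofReal (Real.exp (-(ρ * (volume B).toReal * x.toReal))) := by
  have hm : 0 ≤ ρ * (volume B).toReal := mul_nonneg hρ ENNReal.toReal_nonneg
  have hx' : x ≠ ∞ := ne_top_of_le_ne_top ENNReal.one_ne_top hx
  have hN : Measurable fun ω => (pointCount (fun k => X k ω) B).toNat :=
    measurable_from_top.comp (h.measurable_pointCount hB)
  have hs : 1 - x = ENNReal.ofReal (1 - x.toReal) := by
    rw [ENNReal.ofReal_sub _ ENNReal.toReal_nonneg, ENNReal.ofReal_one, ENNReal.ofReal_toReal hx']
  have hs0 : 0 ≤ 1 - x.toReal := by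
    have := ENNReal.toReal_mono ENNReal.one_ne_top hx
    rw [ENNReal.toReal_one] at this; linarith
  -- `toNat` sends `⊤` to `0`, but an infinite count has probability zero.
  have hlaw : ∀ n : ℕ, μ.map (fun ω => (pointCount (fun k => X k ω) B).toNat) {n} =
      ENNReal.ofReal (Real.exp (-(ρ * (volume B).toReal)) * (ρ * (volume B).toReal) ^ n /
        (n.factorial : ℝ)) := fun n => by
    rw [Measure.map_apply hN (measurableSet_singleton n), ← h.poisson B hB hBt n]
    refine measure_congr ?_
    filter_upwards [h.ae_pointCount_ne_top hρ hB hBt] with ω hω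
    refine propext ?_
    change (pointCount (fun k => X k ω) B).toNat = n ↔ pointCount (fun k => X k ω) B = n
    obtain ⟨m, hm⟩ := ENat.ne_top_iff_exists.1 hω
    rw [← hm]
    simp
  have hsum := hasSum_poisson_mul_pow (ρ * (volume B).toReal) (1 - x.toReal)
  have hmap : ∫⁻ ω, (1 - x) ^ (pointCount (fun k => X k ω) B).toNat ∂μ =
      ∫⁻ n, (1 - x) ^ n ∂(μ.map fun ω => (pointCount (fun k => X k ω) B).toNat) :=
    (lintegral_map (measurable_of_countable _) hN).symm
  rw [hmap, lintegral_countable']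
  simp only [hlaw]
  rw [sub_sub_cancel] at hsum
  rw [← hsum.tsum_eq, ENNReal.ofReal_tsum_of_nonneg _ hsum.summable]
  · refine tsum_congr fun n => ?_
    rw [hs, ENNReal.ofReal_mul (pow_nonneg hs0 n), ENNReal.ofReal_pow hs0]
  · intro n; positivity

open Classical in
lemma card_filter_eventually_eq {B : Set Plane} {x : ℕ → Plane} (hx : pointCount x B ≠ ⊤) :
    ∀ᶠ K in atTop, ((Finset.range K).filter fun k => x k ∈ B).card = (pointCount x B).toNat := by
  have hfin : {k | x k ∈ B}.Finite := Set.encard_ne_top_iff.1 hx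
  obtain ⟨K₀, hK₀⟩ := hfin.bddAbove
  filter_upwards [eventually_gt_atTop K₀] with K hK
  rw [pointCount, ← Set.ncard_def, Set.ncard_eq_toFinset_card _ hfin]
  congr 1
  ext k
  simp only [Finset.mem_filter, Finset.mem_range, Set.Finite.mem_toFinset, Set.mem_ofPred_eq]
  exact ⟨fun h => h.2, fun h => ⟨lt_of_le_of_lt (hK₀ h) hK, h⟩⟩

lemma antitone_prod_one_sub {E : Type*} (w : E → ℝ≥0∞) (y : ℕ → E) :
    Antitone fun K => ∏ k ∈ Finset.range K, (1 - w (y k)) := by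
  refine antitone_nat_of_succ_le fun K => ?_
  rw [Finset.prod_range_succ]
  exact mul_le_of_le_one_right' tsub_le_self

-- Factors are grouped by the value of `u`. The value `0` is left out: its factors are `1`, and its
-- fibre may have infinite area.
open Classical in
lemma prod_one_sub_simpleFunc (u : SimpleFunc Plane ℝ≥0∞) (x : ℕ → Plane) (K : ℕ) :
    ∏ k ∈ Finset.range K, (1 - u (x k)) = ∏ r ∈ u.range.erase 0,
      (1 - r) ^ ((Finset.range K).filter fun k => x k ∈ u ⁻¹' {r}).card := by
  simp only [← Finset.prod_const, Finset.prod_filter]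
  rw [Finset.prod_comm]
  refine Finset.prod_congr rfl fun k _ => ?_
  simp only [Set.mem_preimage, Set.mem_singleton_iff]
  rw [Finset.prod_ite_eq]
  by_cases h0 : u (x k) = 0
  · simp [h0]
  · simp [h0]

/-- The fibres of `u` over nonzero values are disjoint with finite area, so their counts are
independent Poisson variables. The expectation factors into their generating functions, and the
exponents add up to the integral of `u`. -/
lemma pgfl_simpleFunc [IsProbabilityMeasure μ] (h : IsHomogeneousPPP μ ρ X) (hρ : 0 ≤ ρ)
    (u : SimpleFunc Plane ℝ≥0∞) (hu : ∀ x, u x ≤ 1) (hsupp : ∀ r, r ≠ 0 → volume (u ⁻¹' {r}) ≠ ∞) :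
    ∫⁻ ω, ⨅ K : ℕ, ∏ k ∈ Finset.range K, (1 - u (X k ω)) ∂μ =
      ENNReal.ofReal (Real.exp (-(ρ * (∫⁻ x, u x).toReal))) := by
  classical
  set R := u.range.erase 0 with hR
  have hRt : ∀ r ∈ R, volume (u ⁻¹' {r}) ≠ ∞ := fun r hr => hsupp r (Finset.ne_of_mem_erase hr)
  have hR1 : ∀ r ∈ R, r ≤ 1 := fun r hr => by
    obtain ⟨x, rfl⟩ := SimpleFunc.mem_range.1 (Finset.mem_of_mem_erase hr)
    exact hu x
  have hBm : ∀ r, MeasurableSet (u ⁻¹' {r}) := fun r => u.measurableSet_fiber r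
  have hpt : ∀ᵐ ω ∂μ, ⨅ K : ℕ, ∏ k ∈ Finset.range K, (1 - u (X k ω)) =
      ∏ r : R, (1 - (r : ℝ≥0∞)) ^ (pointCount (fun k => X k ω) (u ⁻¹' {(r : ℝ≥0∞)})).toNat := by
    have hae : ∀ᵐ ω ∂μ, ∀ r : R, pointCount (fun k => X k ω) (u ⁻¹' {(r : ℝ≥0∞)}) ≠ ⊤ :=
      ae_all_iff.2 fun r => h.ae_pointCount_ne_top hρ (hBm r) (hRt r r.2)
    filter_upwards [hae] with ω hω
    refine tendsto_nhds_unique (tendsto_atTop_iInf (antitone_prod_one_sub u fun k => X k ω)) ?_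
    refine tendsto_const_nhds.congr' ?_
    have hev := eventually_all.2 fun r : R => card_filter_eventually_eq (hω r)
    filter_upwards [hev] with K hK
    rw [prod_one_sub_simpleFunc u (fun k => X k ω), ← hR, ← Finset.prod_coe_sort R]
    exact Finset.prod_congr rfl fun r _ => by rw [hK r]
  have hind : iIndepFun (fun (r : R) ω => pointCount (fun k => X k ω) (u ⁻¹' {(r : ℝ≥0∞)})) μ := by
    let e := Fintype.equivFin R
    have := h.indep (Fintype.card R) (fun i => u ⁻¹' {((e.symm i : R) : ℝ≥0∞)})
      (fun i => hBm _) (fun i => hRt _ (e.symm i).2) (fun i j hij => by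
        refine Set.disjoint_left.2 fun x hx hx' => hij ?_
        have h1 : u x = (e.symm i : R) := hx
        have h2 : u x = (e.symm j : R) := hx'
        exact e.symm.injective (Subtype.ext (h1.symm.trans h2)))
    simpa using this.precomp e.injective
  have hind' := hind.comp (fun r (n : ℕ∞) => (1 - (r : ℝ≥0∞)) ^ n.toNat)
    fun r => measurable_of_countable _
  rw [lintegral_congr_ae hpt]
  have hprod := lintegral_prod_eq_prod_lintegral_of_indepFun Finset.univ _ hind'
    fun r => (measurable_of_countable _).comp (h.measurable_pointCount (hBm r))
  simp only [Function.comp] at hprod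
  rw [hprod]
  have : ∀ r : R, ∫⁻ ω, (1 - (r : ℝ≥0∞)) ^
      (pointCount (fun k => X k ω) (u ⁻¹' {(r : ℝ≥0∞)})).toNat ∂μ = ENNReal.ofReal
        (Real.exp (-(ρ * (volume (u ⁻¹' {(r : ℝ≥0∞)})).toReal * (r : ℝ≥0∞).toReal))) :=
    fun r => h.lintegral_pow_pointCount hρ (hBm r) (hRt r r.2) (hR1 r r.2)
  simp only [this]
  rw [Finset.prod_coe_sort R (fun r : ℝ≥0∞ => ENNReal.ofReal
        (Real.exp (-(ρ * (volume (u ⁻¹' {r})).toReal * r.toReal)))),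
    ← ENNReal.ofReal_prod_of_nonneg fun _ _ => (Real.exp_pos _).le, ← Real.exp_sum]
  congr 2
  rw [SimpleFunc.lintegral_eq_lintegral, SimpleFunc.lintegral,
    ← Finset.sum_erase u.range (a := 0) (by simp), ENNReal.toReal_sum, Finset.mul_sum,
    ← Finset.sum_neg_distrib]
  · refine Finset.sum_congr rfl fun r _ => ?_
    rw [ENNReal.toReal_mul]; ring
  · exact fun r hr => ENNReal.mul_ne_top
      (ne_top_of_le_ne_top ENNReal.one_ne_top (hR1 r hr)) (hRt r hr)

/-- The probability generating functional of a homogeneous Poisson point process. -/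
lemma pgfl [IsProbabilityMeasure μ] (h : IsHomogeneousPPP μ ρ X) (hρ : 0 ≤ ρ)
    {u : Plane → ℝ≥0∞} (hum : Measurable u) (hu : ∀ x, u x ≤ 1) (hint : ∫⁻ x, u x ≠ ∞) :
    ∫⁻ ω, ⨅ K : ℕ, ∏ k ∈ Finset.range K, (1 - u (X k ω)) ∂μ =
      ENNReal.ofReal (Real.exp (-(ρ * (∫⁻ x, u x).toReal))) := by
  have hball : ∀ n : ℕ, MeasurableSet (Metric.closedBall (0 : Plane) n) := fun n =>
    Metric.isClosed_closedBall.measurableSet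
  -- The cut-off to a ball gives the nonzero fibres finite area, and `v n` still increases to `u`.
  set v : ℕ → SimpleFunc Plane ℝ≥0∞ := fun n =>
    (SimpleFunc.eapprox u n).restrict (Metric.closedBall 0 n) with hv
  have hvapp : ∀ n x, v n x = (Metric.closedBall (0 : Plane) n).indicator
      (SimpleFunc.eapprox u n) x := fun n x => SimpleFunc.restrict_apply _ (hball n) x
  have hle : ∀ n x, SimpleFunc.eapprox u n x ≤ u x := fun n x => by
    rw [← SimpleFunc.iSup_eapprox_apply hum x]; exact le_iSup (fun n => SimpleFunc.eapprox u n x) n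
  have hvle : ∀ n x, v n x ≤ u x := fun n x => by
    rw [hvapp]; exact (Set.indicator_le_self _ _ x).trans (hle n x)
  have hmono : ∀ x, Monotone fun n => v n x := fun x a b hab => by
    simp only [hvapp]
    refine (Set.indicator_le_indicator (SimpleFunc.monotone_eapprox u hab x)).trans ?_
    exact Set.indicator_le_indicator_of_subset
      (Metric.closedBall_subset_closedBall (Nat.cast_le.2 hab)) (fun _ => zero_le) x
  have hlim : ∀ x, Tendsto (fun n => v n x) atTop (𝓝 (u x)) := fun x => by
    have h1 : Tendsto (fun n => SimpleFunc.eapprox u n x) atTop (𝓝 (u x)) := by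
      rw [← SimpleFunc.iSup_eapprox_apply hum x]
      exact tendsto_atTop_iSup fun a b hab => SimpleFunc.monotone_eapprox u hab x
    refine h1.congr' ?_
    obtain ⟨n₀, hn₀⟩ := exists_nat_ge ‖x‖
    filter_upwards [eventually_ge_atTop n₀] with n hn
    rw [hvapp, Set.indicator_of_mem]
    rw [mem_closedBall_zero_iff]
    exact hn₀.trans (Nat.cast_le.2 hn)
  have hsimple : ∀ n, ∫⁻ ω, ⨅ K : ℕ, ∏ k ∈ Finset.range K, (1 - v n (X k ω)) ∂μ =
      ENNReal.ofReal (Real.exp (-(ρ * (∫⁻ x, v n x).toReal))) := fun n => by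
    refine h.pgfl_simpleFunc hρ (v n) (fun x => (hvle n x).trans (hu x)) fun r hr => ?_
    refine ne_top_of_le_ne_top (measure_closedBall_lt_top (x := (0 : Plane)) (r := n)).ne
      (measure_mono fun x hx => ?_)
    by_contra hxb
    refine hr ?_
    have : v n x = r := hx
    rw [← this, hvapp, Set.indicator_of_notMem hxb]
  have hvanti : ∀ K, ∀ ω, Antitone fun n => ∏ k ∈ Finset.range K, (1 - v n (X k ω)) :=
    fun K ω a b hab => Finset.prod_le_prod' fun k _ => tsub_le_tsub_left (hmono _ hab) 1
  have hprod : ∀ K, ∀ ω, ⨅ n, ∏ k ∈ Finset.range K, (1 - v n (X k ω)) =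
      ∏ k ∈ Finset.range K, (1 - u (X k ω)) := fun K ω => by
    refine tendsto_nhds_unique (tendsto_atTop_iInf (hvanti K ω)) ?_
    refine ENNReal.tendsto_finsetProd_of_ne_top _ (fun k _ => ?_) fun k _ =>
      ne_top_of_le_ne_top ENNReal.one_ne_top tsub_le_self
    exact ENNReal.Tendsto.sub tendsto_const_nhds (hlim _) (Or.inl ENNReal.one_ne_top)
  have hmeas : ∀ n, Measurable fun ω => ⨅ K : ℕ, ∏ k ∈ Finset.range K, (1 - v n (X k ω)) :=
    fun n => Measurable.iInf fun K => Finset.measurable_fun_prod _ fun k _ =>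
      measurable_const.sub ((v n).measurable.comp (h.measurable k))
  have hle1 : ∀ n ω, ⨅ K : ℕ, ∏ k ∈ Finset.range K, (1 - v n (X k ω)) ≤ 1 := fun n ω =>
    iInf_le_of_le 0 (by simp)
  have hanti : Antitone fun n => fun ω => ⨅ K : ℕ, ∏ k ∈ Finset.range K, (1 - v n (X k ω)) :=
    fun a b hab ω => iInf_mono fun K => hvanti K ω hab
  -- The infima over `n` and `K` commute, and monotone convergence for decreasing sequences applies
  -- because everything is at most `1`.
  have hswap : ∫⁻ ω, ⨅ K : ℕ, ∏ k ∈ Finset.range K, (1 - u (X k ω)) ∂μ =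
      ⨅ n, ∫⁻ ω, ⨅ K : ℕ, ∏ k ∈ Finset.range K, (1 - v n (X k ω)) ∂μ := by
    rw [← lintegral_iInf hmeas hanti]
    · refine lintegral_congr fun ω => ?_
      rw [iInf_comm]
      exact iInf_congr fun K => (hprod K ω).symm
    · refine ne_top_of_le_ne_top ENNReal.one_ne_top ?_
      calc _ ≤ ∫⁻ _, 1 ∂μ := lintegral_mono fun ω => hle1 0 ω
        _ = 1 := by simp
  rw [hswap]
  refine tendsto_nhds_unique
    (tendsto_atTop_iInf fun a b hab => lintegral_mono (hanti hab)) ?_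
  simp only [hsimple]
  have hconv : Tendsto (fun n => ∫⁻ x, v n x) atTop (𝓝 (∫⁻ x, u x)) :=
    lintegral_tendsto_of_tendsto_of_monotone (fun n => (v n).measurable.aemeasurable)
      (ae_of_all _ hmono) (ae_of_all _ hlim)
  refine ENNReal.tendsto_ofReal ((Real.continuous_exp.tendsto _).comp ?_)
  exact (((ENNReal.tendsto_toReal hint).comp hconv).const_mul ρ).neg

end MmWave.IsHomogeneousPPP

/-! ### From positions to links: polar coordinates and marking. -/

namespace MmWave

/-- Both measures give `(-∞, a]` the area of the disc of radius `a`. Restricting to `(-∞, n]` makes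
them finite, as uniqueness from half-lines requires. -/
lemma map_norm_volume : (volume : Measure Plane).map norm =
    (volume.restrict (Set.Ioi (0 : ℝ))).withDensity fun r => ENNReal.ofReal (2 * Real.pi * r) := by
  have hIic : ∀ a : ℝ, (volume : Measure Plane).map norm (Set.Iic a) =
      ((volume.restrict (Set.Ioi (0 : ℝ))).withDensity fun r =>
        ENNReal.ofReal (2 * Real.pi * r)) (Set.Iic a) := fun a => by
    rw [Measure.map_apply measurable_norm measurableSet_Iic, withDensity_apply _ measurableSet_Iic,
      Measure.restrict_restrict measurableSet_Iic]
    have hball : (norm : Plane → ℝ) ⁻¹' Set.Iic a = Metric.closedBall 0 a := by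
      ext x; simp
    rw [hball, EuclideanSpace.volume_closedBall_fin_two]
    have hIoc : Set.Iic a ∩ Set.Ioi 0 = Set.Ioc 0 a := by
      ext x; simp [and_comm]
    rw [hIoc]
    rcases lt_or_ge a 0 with ha | ha
    · rw [Set.Ioc_eq_empty (not_lt.2 ha.le), ENNReal.ofReal_of_nonpos ha.le]
      simp
    · have hi : IntervalIntegrable (fun r : ℝ => 2 * Real.pi * r) volume 0 a :=
        (continuous_const.mul continuous_id).intervalIntegrable _ _
      rw [← ofReal_integral_eq_lintegral_ofReal hi.1, ← intervalIntegral.integral_of_le ha,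
        intervalIntegral.integral_const_mul, integral_id, ← ENNReal.ofReal_pow ha,
        ← ENNReal.ofReal_mul (by positivity)]
      · congr 1; ring
      · refine (ae_restrict_iff' measurableSet_Ioc).2 (ae_of_all _ fun r hr => ?_)
        have := hr.1
        simp only [Pi.zero_apply]; positivity
  have hfin : ∀ n : ℕ, (volume : Measure Plane).map norm (Set.Iic (n : ℝ)) < ∞ := fun n => by
    rw [Measure.map_apply measurable_norm measurableSet_Iic]
    have hball : (norm : Plane → ℝ) ⁻¹' Set.Iic (n : ℝ) = Metric.closedBall 0 n := by
      ext x; simp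
    rw [hball]
    exact measure_closedBall_lt_top
  have hcover : ⋃ n : ℕ, Set.Iic (n : ℝ) = Set.univ := by
    ext x; simpa using exists_nat_ge x
  refine (Measure.ext_iff_of_iUnion_eq_univ hcover).2 fun n => ?_
  have : IsFiniteMeasure (((volume : Measure Plane).map norm).restrict (Set.Iic (n : ℝ))) :=
    ⟨by rw [Measure.restrict_apply_univ]; exact hfin n⟩
  refine Measure.ext_of_Iic _ _ fun a => ?_
  rw [Measure.restrict_apply measurableSet_Iic, Measure.restrict_apply measurableSet_Iic,
    Set.Iic_inter_Iic, hIic]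

lemma lintegral_fun_norm {g : ℝ → ℝ≥0∞} (hg : Measurable g) :
    ∫⁻ x : Plane, g ‖x‖ = ∫⁻ r in Set.Ioi (0 : ℝ), ENNReal.ofReal (2 * Real.pi * r) * g r := by
  have hd : Measurable fun r : ℝ => ENNReal.ofReal (2 * Real.pi * r) :=
    (measurable_id.const_mul (2 * Real.pi)).ennreal_ofReal
  rw [← lintegral_map hg measurable_norm, map_norm_volume,
    lintegral_withDensity_eq_lintegral_mul _ hd hg]
  rfl

namespace Params

variable (p : Params)

/-- Probability that a link of length `R` has LoS state `b`. -/
noncomputable def linkProb (b : Bool) (R : ℝ) : ℝ := if b then p.fPr R else 1 - p.fPr R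

lemma measurable_linkProb (b : Bool) : Measurable (p.linkProb b) := by
  cases b
  · exact p.fPr_measurable.const_sub 1
  · exact p.fPr_measurable

lemma linkProb_nonneg (b : Bool) {R : ℝ} (hR : 0 ≤ R) : 0 ≤ p.linkProb b R := by
  have := p.fPr_mem R hR
  cases b <;> simp [linkProb, this.1, this.2]

lemma linkProb_le_one (b : Bool) {R : ℝ} (hR : 0 ≤ R) : p.linkProb b R ≤ 1 := by
  have := p.fPr_mem R hR
  cases b <;> simp [linkProb, this.1, this.2]

lemma ofReal_linkProb_add {R : ℝ} (hR : 0 ≤ R) :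
    ENNReal.ofReal (p.linkProb true R) + ENNReal.ofReal (p.linkProb false R) = 1 := by
  rw [← ENNReal.ofReal_add (p.linkProb_nonneg _ hR) (p.linkProb_nonneg _ hR)]
  simp [linkProb]

/-- Density of the lengths of the links in LoS state `b`. -/
noncomputable def linkDensity (b : Bool) (r : ℝ) : ℝ≥0∞ :=
  ENNReal.ofReal (2 * Real.pi * p.ρ * (r * p.linkProb b r))

lemma measurable_linkDensity (b : Bool) : Measurable (p.linkDensity b) :=
  ((measurable_id.mul (p.measurable_linkProb b)).const_mul _).ennreal_ofReal

/-- Intensity of the process of lengths and LoS states of the links. -/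
noncomputable def linkIntensity : Measure (ℝ × Bool) :=
  ((volume.restrict (Set.Ioi (0 : ℝ))).withDensity (p.linkDensity true)).map (fun r => (r, true)) +
  ((volume.restrict (Set.Ioi (0 : ℝ))).withDensity (p.linkDensity false)).map
    (fun r => (r, false))

lemma lintegral_linkIntensity {g : ℝ × Bool → ℝ≥0∞} (hg : Measurable g) :
    ∫⁻ y, g y ∂p.linkIntensity =
      (∫⁻ r in Set.Ioi (0 : ℝ), p.linkDensity true r * g (r, true)) +
        ∫⁻ r in Set.Ioi (0 : ℝ), p.linkDensity false r * g (r, false) := by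
  have hm : ∀ b : Bool, Measurable fun r : ℝ => (r, b) := fun b =>
    measurable_id.prodMk measurable_const
  have hgm : ∀ b : Bool, Measurable fun r : ℝ => g (r, b) := fun b => hg.comp (hm b)
  rw [linkIntensity, lintegral_add_measure, lintegral_map hg (hm _), lintegral_map hg (hm _),
    lintegral_withDensity_eq_lintegral_mul _ (p.measurable_linkDensity _) (hgm _),
    lintegral_withDensity_eq_lintegral_mul _ (p.measurable_linkDensity _) (hgm _)]
  rfl

end Params

namespace Network.IsModel

variable {Ω : Type*} [MeasurableSpace Ω] {μ : Measure Ω} {W : Network Ω} {p : Params}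

lemma measurable_pos (hW : W.IsModel p μ) : Measurable fun ω => fun k => W.pos k ω :=
  measurable_pi_lambda _ fun k => hW.ppp.measurable k

/-- The hypothesis `los_law` is the case of an indicator `G`. It identifies two measures on
configurations, hence their integrals. -/
lemma setLIntegral_los (hW : W.IsModel p μ) (I : Finset ℕ) (b : ℕ → Bool)
    {G : (ℕ → Plane) → ℝ≥0∞} (hG : Measurable G) :
    ∫⁻ ω in {ω | ∀ k ∈ I, W.los k ω = b k}, G (fun k => W.pos k ω) ∂μ =
      ∫⁻ ω, (∏ k ∈ I, ENNReal.ofReal (p.linkProb (b k) ‖W.pos k ω‖)) *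
        G (fun k => W.pos k ω) ∂μ := by
  have hpos := hW.measurable_pos
  have hS : MeasurableSet {ω | ∀ k ∈ I, W.los k ω = b k} := by
    have : {ω | ∀ k ∈ I, W.los k ω = b k} = ⋂ k ∈ I, W.los k ⁻¹' {b k} := by
      ext ω; simp
    rw [this]
    exact Finset.measurableSet_biInter _ fun k _ => hW.los_measurable k (measurableSet_singleton _)
  have hD : Measurable fun ω => ∏ k ∈ I, ENNReal.ofReal (p.linkProb (b k) ‖W.pos k ω‖) :=
    Finset.measurable_fun_prod _ fun k _ =>
      ((p.measurable_linkProb _).comp (hW.ppp.measurable k).norm).ennreal_ofReal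
  have key : (μ.restrict {ω | ∀ k ∈ I, W.los k ω = b k}).map (fun ω k => W.pos k ω) =
      (μ.withDensity fun ω => ∏ k ∈ I, ENNReal.ofReal (p.linkProb (b k) ‖W.pos k ω‖)).map
        (fun ω k => W.pos k ω) := by
    refine Measure.ext fun A hA => ?_
    rw [Measure.map_apply hpos hA, Measure.map_apply hpos hA, withDensity_apply _ (hpos hA),
      Measure.restrict_apply (hpos hA)]
    exact hW.los_law A hA I b
  have hGpos : Measurable fun ω => G fun k => W.pos k ω := hG.comp hpos
  rw [← lintegral_map hG hpos, key, lintegral_map hG hpos,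
    lintegral_withDensity_eq_lintegral_mul _ hD hGpos]
  rfl

/-- Averaging over the LoS states given the positions. -/
lemma lintegral_prod_links (hW : W.IsModel p μ) {a : ℝ × Bool → ℝ≥0∞} (ha : Measurable a)
    (I : Finset ℕ) :
    ∫⁻ ω, ∏ k ∈ I, a (‖W.pos k ω‖, W.los k ω) ∂μ =
      ∫⁻ ω, ∏ k ∈ I, (ENNReal.ofReal (p.linkProb true ‖W.pos k ω‖) * a (‖W.pos k ω‖, true) +
        ENNReal.ofReal (p.linkProb false ‖W.pos k ω‖) * a (‖W.pos k ω‖, false)) ∂μ := by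
  have ham : ∀ b : Bool, Measurable fun r : ℝ => a (r, b) := fun b =>
    ha.comp (measurable_id.prodMk measurable_const)
  -- The index `t` is the set of LoS links within `I`. Both sides expand into sums over `t`, which
  -- agree term by term by `setLIntegral_los`.
  set G : Finset ℕ → (ℕ → Plane) → ℝ≥0∞ := fun t x =>
    (∏ k ∈ t, a (‖x k‖, true)) * ∏ k ∈ I \ t, a (‖x k‖, false) with hGdef
  have hG : ∀ t, Measurable (G t) := fun t =>
    (Finset.measurable_fun_prod _ fun k _ => (ham true).comp (measurable_pi_apply k).norm).mul
      (Finset.measurable_fun_prod _ fun k _ => (ham false).comp (measurable_pi_apply k).norm)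
  set S : Finset ℕ → Set Ω := fun t => {ω | ∀ k ∈ I, W.los k ω = decide (k ∈ t)} with hSdef
  have hS : ∀ t, MeasurableSet (S t) := fun t => by
    have : S t = ⋂ k ∈ I, W.los k ⁻¹' {decide (k ∈ t)} := by
      ext ω; simp [hSdef]
    rw [this]
    exact Finset.measurableSet_biInter _ fun k _ => hW.los_measurable k (measurableSet_singleton _)
  have hl : ∀ ω, ∏ k ∈ I, a (‖W.pos k ω‖, W.los k ω) =
      ∑ t ∈ I.powerset, (S t).indicator (fun ω => G t fun k => W.pos k ω) ω := fun ω => by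
    have hsplit : ∀ k, a (‖W.pos k ω‖, W.los k ω) =
        (if W.los k ω = true then a (‖W.pos k ω‖, true) else 0) +
        (if W.los k ω = false then a (‖W.pos k ω‖, false) else 0) := fun k => by
      cases W.los k ω <;> simp
    simp only [hsplit]
    rw [Finset.prod_add]
    refine Finset.sum_congr rfl fun t ht => ?_
    rw [Finset.mem_powerset] at ht
    by_cases hω : ω ∈ S t
    · rw [Set.indicator_of_mem hω, hGdef]
      have hω' : ∀ k ∈ I, W.los k ω = decide (k ∈ t) := hω
      congr 1
      · exact Finset.prod_congr rfl fun k hk => by rw [if_pos (by simp [hω' k (ht hk), hk])]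
      · refine Finset.prod_congr rfl fun k hk => ?_
        rw [Finset.mem_sdiff] at hk
        rw [if_pos (by simp [hω' k hk.1, hk.2])]
    · rw [Set.indicator_of_notMem hω]
      have : ∃ k ∈ I, W.los k ω ≠ decide (k ∈ t) := by
        by_contra hcon; push Not at hcon; exact hω hcon
      obtain ⟨k, hkI, hk⟩ := this
      by_cases hkt : k ∈ t
      · rw [Finset.prod_eq_zero hkt, zero_mul]
        rw [if_neg (by simpa [hkt] using hk)]
      · rw [Finset.prod_eq_zero (s := I \ t) (Finset.mem_sdiff.2 ⟨hkI, hkt⟩), mul_zero]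
        rw [if_neg (by simpa [hkt] using hk)]
  simp only [hl]
  have hGS : ∀ t, Measurable ((S t).indicator fun ω => G t fun k => W.pos k ω) := fun t =>
    ((hG t).comp hW.measurable_pos).indicator (hS t)
  rw [lintegral_finsetSum _ fun t _ => hGS t]
  have hr : ∀ ω, ∏ k ∈ I, (ENNReal.ofReal (p.linkProb true ‖W.pos k ω‖) * a (‖W.pos k ω‖, true) +
        ENNReal.ofReal (p.linkProb false ‖W.pos k ω‖) * a (‖W.pos k ω‖, false)) =
      ∑ t ∈ I.powerset, (∏ k ∈ I, ENNReal.ofReal (p.linkProb (decide (k ∈ t)) ‖W.pos k ω‖)) *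
        G t fun k => W.pos k ω := fun ω => by
    rw [Finset.prod_add]
    refine Finset.sum_congr rfl fun t ht => ?_
    rw [Finset.mem_powerset] at ht
    rw [← Finset.prod_sdiff ht, hGdef, Finset.prod_mul_distrib, Finset.prod_mul_distrib]
    have h1 : ∏ k ∈ t, ENNReal.ofReal (p.linkProb (decide (k ∈ t)) ‖W.pos k ω‖) =
        ∏ k ∈ t, ENNReal.ofReal (p.linkProb true ‖W.pos k ω‖) :=
      Finset.prod_congr rfl fun k hk => by simp [hk]
    have h2 : ∏ k ∈ I \ t, ENNReal.ofReal (p.linkProb (decide (k ∈ t)) ‖W.pos k ω‖) =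
        ∏ k ∈ I \ t, ENNReal.ofReal (p.linkProb false ‖W.pos k ω‖) :=
      Finset.prod_congr rfl fun k hk => by simp [(Finset.mem_sdiff.1 hk).2]
    rw [h1, h2]
    ring
  simp only [hr]
  rw [lintegral_finsetSum]
  · refine Finset.sum_congr rfl fun t _ => ?_
    rw [lintegral_indicator (hS t)]
    exact hW.setLIntegral_los I (fun k => decide (k ∈ t)) (hG t)
  · exact fun t _ => (Finset.measurable_fun_prod _ fun k _ =>
      ((p.measurable_linkProb _).comp (hW.ppp.measurable k).norm).ennreal_ofReal).mul
        ((hG t).comp hW.measurable_pos)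

/-- The lengths and LoS states of the links form a Poisson process. -/
lemma hasPoissonPGFL [IsProbabilityMeasure μ] (hW : W.IsModel p μ) :
    HasPoissonPGFL μ p.linkIntensity (fun k ω => (‖W.pos k ω‖, W.los k ω)) where
  measurable k := (hW.ppp.measurable k).norm.prodMk (hW.los_measurable k)
  pgfl w hwm hw hint := by
    have hYm : ∀ k, Measurable fun ω => (‖W.pos k ω‖, W.los k ω) := fun k =>
      (hW.ppp.measurable k).norm.prodMk (hW.los_measurable k)
    have hwb : ∀ b : Bool, Measurable fun r : ℝ => w (r, b) := fun b =>
      hwm.comp (measurable_id.prodMk measurable_const)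
    -- The mean of `w` over the LoS state of a link of given length. Averaging replaces each factor
    -- `1 - w` by `1 - u₀`, a function of the position alone.
    set u₀ : ℝ → ℝ≥0∞ := fun r => ENNReal.ofReal (p.linkProb true r) * w (r, true) +
      ENNReal.ofReal (p.linkProb false r) * w (r, false) with hu₀
    have hu₀m : Measurable u₀ :=
      ((p.measurable_linkProb true).ennreal_ofReal.mul (hwb true)).add
        ((p.measurable_linkProb false).ennreal_ofReal.mul (hwb false))
    have hu₀le : ∀ x : Plane, u₀ ‖x‖ ≤ 1 := fun x => by
      rw [← p.ofReal_linkProb_add (norm_nonneg x)]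
      exact add_le_add (mul_le_of_le_one_right' (hw _)) (mul_le_of_le_one_right' (hw _))
    have hone : ∀ x : Plane, ENNReal.ofReal (p.linkProb true ‖x‖) * (1 - w (‖x‖, true)) +
        ENNReal.ofReal (p.linkProb false ‖x‖) * (1 - w (‖x‖, false)) = 1 - u₀ ‖x‖ := fun x => by
      refine ENNReal.eq_sub_of_add_eq (ne_top_of_le_ne_top ENNReal.one_ne_top (hu₀le x)) ?_
      rw [hu₀, add_add_add_comm, ← mul_add, ← mul_add, tsub_add_cancel_of_le (hw _),
        tsub_add_cancel_of_le (hw _), mul_one, mul_one, p.ofReal_linkProb_add (norm_nonneg x)]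
    have hK : ∀ K : ℕ, ∫⁻ ω, ∏ k ∈ Finset.range K, (1 - w (‖W.pos k ω‖, W.los k ω)) ∂μ =
        ∫⁻ ω, ∏ k ∈ Finset.range K, (1 - u₀ ‖W.pos k ω‖) ∂μ := fun K => by
      rw [hW.lintegral_prod_links (hwm.const_sub 1)]
      simp only [hone]
    -- States are averaged over finitely many links at a time, so the infimum over `K` is taken out
    -- of the integral and put back afterwards.
    have hswap : ∀ v : ℕ → Ω → ℝ≥0∞, (∀ k, Measurable (v k)) →
        ∫⁻ ω, ⨅ K : ℕ, ∏ k ∈ Finset.range K, (1 - v k ω) ∂μ =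
          ⨅ K : ℕ, ∫⁻ ω, ∏ k ∈ Finset.range K, (1 - v k ω) ∂μ := fun v hv => by
      refine lintegral_iInf (fun K => Finset.measurable_fun_prod _ fun k _ => (hv k).const_sub 1)
        (fun a b hab ω => ?_) (by simp)
      exact Finset.prod_le_prod_of_subset_of_le_one' (Finset.range_mono hab)
        fun _ _ _ => tsub_le_self
    rw [hswap (fun k ω => w (‖W.pos k ω‖, W.los k ω)) fun k => hwm.comp (hYm k)]
    simp only [hK]
    have hux : Measurable fun x : Plane => u₀ ‖x‖ := hu₀m.comp measurable_norm
    rw [← hswap (fun k ω => u₀ ‖W.pos k ω‖) fun k => hux.comp (hW.ppp.measurable k)]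
    have hΛ : ∫⁻ y, w y ∂p.linkIntensity = ENNReal.ofReal p.ρ * ∫⁻ x : Plane, u₀ ‖x‖ := by
      have hdw : Measurable fun r => p.linkDensity true r * w (r, true) :=
        (p.measurable_linkDensity _).mul (hwb _)
      have hdu : Measurable fun r => ENNReal.ofReal (2 * Real.pi * r) * u₀ r :=
        ((measurable_id.const_mul (2 * Real.pi)).ennreal_ofReal).mul hu₀m
      rw [p.lintegral_linkIntensity hwm, lintegral_fun_norm hu₀m,
        ← lintegral_add_left hdw, ← lintegral_const_mul _ hdu]
      refine setLIntegral_congr_fun measurableSet_Ioi fun r hr => ?_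
      have hr0 : (0 : ℝ) ≤ r := le_of_lt hr
      have hd : ∀ b, p.linkDensity b r = ENNReal.ofReal p.ρ *
          (ENNReal.ofReal (2 * Real.pi * r) * ENNReal.ofReal (p.linkProb b r)) := fun b => by
        rw [← ENNReal.ofReal_mul (by positivity), ← ENNReal.ofReal_mul p.ρ_pos.le,
          Params.linkDensity]
        congr 1; ring
      simp only [hd, hu₀]
      ring
    have hfin : ∫⁻ x : Plane, u₀ ‖x‖ ≠ ∞ := fun htop => by
      rw [hΛ, htop, ENNReal.mul_top (by simpa using p.ρ_pos)] at hint
      exact hint rfl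
    rw [hW.ppp.pgfl p.ρ_pos.le hux hu₀le hfin, hΛ, ENNReal.toReal_mul,
      ENNReal.toReal_ofReal p.ρ_pos.le]

end Network.IsModel

end MmWave

/-! ### The score of a link and the serving station. -/

namespace MmWave

namespace Params

variable (p : Params)

lemma φLoS_nonneg {x : ℝ} (hx : 0 ≤ x) : 0 ≤ p.φLoS x :=
  mul_nonneg (Real.rpow_nonneg (div_pos p.βNLoS_pos p.βLoS_pos).le _) (Real.rpow_nonneg hx _)

lemma φNLoS_pos {x : ℝ} (hx : 0 < x) : 0 < p.φNLoS x :=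
  mul_pos (Real.rpow_pos_of_pos (div_pos p.βLoS_pos p.βNLoS_pos) _) (Real.rpow_pos_of_pos hx _)

/-- Both maps match lengths of equal path loss: `φNLoS` turns an NLoS length into a LoS one, and
`φLoS` goes back. -/
lemma φLoS_φNLoS {x : ℝ} (hx : 0 ≤ x) : p.φLoS (p.φNLoS x) = x := by
  have hβ := div_pos p.βLoS_pos p.βNLoS_pos
  have hL := p.αLoS_pos
  have hN := p.αNLoS_pos
  have hinv : p.βNLoS / p.βLoS = (p.βLoS / p.βNLoS)⁻¹ := (inv_div _ _).symm
  rw [φLoS, φNLoS, Real.mul_rpow (Real.rpow_nonneg hβ.le _) (Real.rpow_nonneg hx _),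
    ← Real.rpow_mul hβ.le, ← Real.rpow_mul hx, hinv, Real.inv_rpow hβ.le]
  have h1 : 1 / p.αLoS * (p.αLoS / p.αNLoS) = 1 / p.αNLoS := by field_simp
  have h2 : p.αNLoS / p.αLoS * (p.αLoS / p.αNLoS) = 1 := by field_simp
  rw [h1, h2, Real.rpow_one, ← mul_assoc,
    inv_mul_cancel₀ (Real.rpow_pos_of_pos hβ _).ne', one_mul]

lemma strictMonoOn_φLoS : StrictMonoOn p.φLoS (Set.Ici 0) := fun _ hx _ _ hxy =>
  mul_lt_mul_of_pos_left (Real.rpow_lt_rpow hx hxy (div_pos p.αLoS_pos p.αNLoS_pos))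
    (Real.rpow_pos_of_pos (div_pos p.βNLoS_pos p.βLoS_pos) _)

lemma φNLoS_lt_iff {r v : ℝ} (hr : 0 < r) (hv : 0 ≤ v) : p.φNLoS r < v ↔ r < p.φLoS v := by
  rw [← p.strictMonoOn_φLoS.lt_iff_lt (p.φNLoS_pos hr).le hv, p.φLoS_φNLoS hr.le]

lemma lt_φNLoS_iff {r v : ℝ} (hr : 0 < r) (hv : 0 ≤ v) : v < p.φNLoS r ↔ p.φLoS v < r := by
  rw [← p.strictMonoOn_φLoS.lt_iff_lt hv (p.φNLoS_pos hr).le, p.φLoS_φNLoS hr.le]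

lemma measurable_φLoS : Measurable p.φLoS :=
  (measurable_id.pow_const (p.αLoS / p.αNLoS)).const_mul _

lemma measurable_φNLoS : Measurable p.φNLoS :=
  (measurable_id.pow_const (p.αNLoS / p.αLoS)).const_mul _

/-- The length of the LoS link with the same path loss as the given link. -/
noncomputable def linkScore (y : ℝ × Bool) : ℝ := if y.2 then y.1 else p.φNLoS y.1

lemma measurable_linkScore : Measurable p.linkScore :=
  Measurable.ite (measurable_snd (measurableSet_singleton true)) measurable_fst
    (p.measurable_φNLoS.comp measurable_fst)

lemma linkScore_pos {y : ℝ × Bool} (hy : 0 < y.1) : 0 < p.linkScore y := by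
  obtain ⟨r, b⟩ := y
  cases b
  · simpa [linkScore] using p.φNLoS_pos hy
  · simpa [linkScore] using hy

/-- Once expressed by the score, the path loss law is one decreasing function for both states, so
the largest value means the least score. -/
lemma pathLoss_eq {y : ℝ × Bool} (hy : 0 < y.1) :
    p.pathLoss y.2 y.1 = p.βLoS * p.linkScore y ^ (-p.αLoS) := by
  obtain ⟨r, b⟩ := y
  have hr : 0 < r := hy
  have hβ := div_pos p.βLoS_pos p.βNLoS_pos
  have hL := p.αLoS_pos
  have hL0 := p.βLoS_pos
  have hN0 := p.βNLoS_pos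
  cases b
  · simp only [pathLoss, linkScore, φNLoS, Bool.false_eq_true, if_false]
    rw [Real.mul_rpow (Real.rpow_nonneg hβ.le _) (Real.rpow_nonneg hr.le _),
      ← Real.rpow_mul hβ.le, ← Real.rpow_mul hr.le]
    have h1 : 1 / p.αLoS * -p.αLoS = -1 := by field_simp
    have h2 : p.αNLoS / p.αLoS * -p.αLoS = -p.αNLoS := by field_simp
    rw [h1, h2, Real.rpow_neg_one, inv_div, ← mul_assoc, mul_div_cancel₀ _ hL0.ne']
  · simp [pathLoss, linkScore]

lemma pathLoss_le_iff {y z : ℝ × Bool} (hy : 0 < y.1) (hz : 0 < z.1) :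
    p.pathLoss y.2 y.1 ≤ p.pathLoss z.2 z.1 ↔ p.linkScore z ≤ p.linkScore y := by
  rw [p.pathLoss_eq hy, p.pathLoss_eq hz, mul_le_mul_iff_right₀ p.βLoS_pos,
    Real.rpow_le_rpow_iff_of_neg (p.linkScore_pos hy) (p.linkScore_pos hz)
      (neg_neg_of_pos p.αLoS_pos)]

lemma linkIntensity_apply {S : Set (ℝ × Bool)} (hS : MeasurableSet S) :
    p.linkIntensity S =
      (∫⁻ r in {r | (r, true) ∈ S} ∩ Set.Ioi 0, p.linkDensity true r) +
        ∫⁻ r in {r | (r, false) ∈ S} ∩ Set.Ioi 0, p.linkDensity false r := by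
  have hm : ∀ b : Bool, Measurable fun r : ℝ => (r, b) := fun b =>
    measurable_id.prodMk measurable_const
  rw [linkIntensity, Measure.add_apply, Measure.map_apply (hm _) hS, Measure.map_apply (hm _) hS,
    withDensity_apply _ (hm _ hS), withDensity_apply _ (hm _ hS),
    Measure.restrict_restrict (hm _ hS), Measure.restrict_restrict (hm _ hS)]
  rfl

lemma intervalIntegrable_linkProb (b : Bool) {v : ℝ} (hv : 0 ≤ v) :
    IntervalIntegrable (fun r => r * p.linkProb b r) volume 0 v := by
  rw [intervalIntegrable_iff_integrableOn_Ioc_of_le hv]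
  refine Measure.integrableOn_of_bounded (M := v) measure_Ioc_lt_top.ne
    (measurable_id.mul (p.measurable_linkProb b)).aestronglyMeasurable ?_
  refine (ae_restrict_iff' measurableSet_Ioc).2 (ae_of_all _ fun r hr => ?_)
  have h0 := p.linkProb_nonneg b hr.1.le
  have h1 := p.linkProb_le_one b hr.1.le
  rw [Real.norm_of_nonneg (mul_nonneg hr.1.le h0)]
  exact (mul_le_of_le_one_right hr.1.le h1).trans hr.2

lemma integral_linkProb_nonneg (b : Bool) {v : ℝ} (hv : 0 ≤ v) :
    0 ≤ ∫ r in (0 : ℝ)..v, r * p.linkProb b r :=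
  intervalIntegral.integral_nonneg hv fun _ hr => mul_nonneg hr.1 (p.linkProb_nonneg b hr.1)

lemma setLIntegral_linkDensity (b : Bool) {v : ℝ} (hv : 0 ≤ v) :
    ∫⁻ r in Set.Ioo 0 v, p.linkDensity b r =
      ENNReal.ofReal (2 * Real.pi * p.ρ * ∫ r in (0 : ℝ)..v, r * p.linkProb b r) := by
  have hi := (p.intervalIntegrable_linkProb b hv).const_mul (2 * Real.pi * p.ρ)
  rw [setLIntegral_congr Ioo_ae_eq_Ioc, ← intervalIntegral.integral_const_mul,
    intervalIntegral.integral_of_le hv, ofReal_integral_eq_lintegral_ofReal hi.1]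
  · rfl
  · refine (ae_restrict_iff' measurableSet_Ioc).2 (ae_of_all _ fun r hr => ?_)
    have h0 := p.linkProb_nonneg b hr.1.le
    have := hr.1
    have := p.ρ_pos
    simp only [Pi.zero_apply]
    positivity

lemma Θ_eq (v : ℝ) : p.Θ v = ∫ r in (0 : ℝ)..v, r * p.linkProb true r := by
  simp [Θ, linkProb]

lemma Ξ_eq (v : ℝ) : p.Ξ v = ∫ r in (0 : ℝ)..v, r * p.linkProb false r := by
  simp [Ξ, linkProb, mul_comm]

lemma Θ_nonneg {v : ℝ} (hv : 0 ≤ v) : 0 ≤ p.Θ v := p.Θ_eq v ▸ p.integral_linkProb_nonneg _ hv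

lemma Ξ_nonneg {v : ℝ} (hv : 0 ≤ v) : 0 ≤ p.Ξ v := p.Ξ_eq v ▸ p.integral_linkProb_nonneg _ hv

/-- A NLoS link scores below `v` exactly when its length is below `φLoS v`; this puts `φLoS` inside
`Ξ` in the exponent. -/
lemma linkIntensity_score_lt {v : ℝ} (hv : 0 ≤ v) :
    p.linkIntensity {y | p.linkScore y < v} =
      ENNReal.ofReal (2 * Real.pi * p.ρ * (p.Θ v + p.Ξ (p.φLoS v))) := by
  have hφ := p.φLoS_nonneg hv
  have hρ : 0 ≤ 2 * Real.pi * p.ρ := by have := p.ρ_pos; positivity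
  have h1 : {r | (r, true) ∈ {y | p.linkScore y < v}} ∩ Set.Ioi 0 = Set.Ioo 0 v := by
    ext r; simp [linkScore, and_comm]
  have h2 : {r | (r, false) ∈ {y | p.linkScore y < v}} ∩ Set.Ioi 0 = Set.Ioo 0 (p.φLoS v) := by
    ext r
    simp only [linkScore, Set.mem_inter_iff, Set.mem_ofPred_eq, Set.mem_Ioi, Set.mem_Ioo,
      Bool.false_eq_true, if_false]
    exact ⟨fun h => ⟨h.2, (p.φNLoS_lt_iff h.2 hv).1 h.1⟩,
      fun h => ⟨(p.φNLoS_lt_iff h.1 hv).2 h.2, h.1⟩⟩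
  have hm : MeasurableSet {y | p.linkScore y < v} := p.measurable_linkScore measurableSet_Iio
  rw [p.linkIntensity_apply hm, h1, h2,
    p.setLIntegral_linkDensity _ hv, p.setLIntegral_linkDensity _ hφ, ← p.Θ_eq, ← p.Ξ_eq,
    ← ENNReal.ofReal_add (mul_nonneg hρ (p.Θ_nonneg hv)) (mul_nonneg hρ (p.Ξ_nonneg hφ)), mul_add]

lemma isScore_linkScore : IsScore p.linkIntensity p.linkScore where
  measurable := p.measurable_linkScore
  measure_lt_ne_top v := by
    -- The explicit intensity is available only for nonnegative levels.
    have hsub : {y | p.linkScore y < v} ⊆ {y | p.linkScore y < max v 0} :=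
      fun y (hy : p.linkScore y < v) => hy.trans_le (le_max_left v 0)
    refine ne_top_of_le_ne_top ?_ (measure_mono hsub)
    rw [p.linkIntensity_score_lt (le_max_right v 0)]
    exact ENNReal.ofReal_ne_top
  measure_eq v := by
    have hm : MeasurableSet {y | p.linkScore y = v} :=
      p.measurable_linkScore (measurableSet_singleton v)
    rw [p.linkIntensity_apply hm, add_eq_zero]
    constructor
    · refine setLIntegral_measure_zero _ _ (measure_mono_null (t := {v}) (fun r hr => ?_) (by simp))
      have h : p.linkScore (r, true) = v := hr.1
      simpa [linkScore] using h
    · refine setLIntegral_measure_zero _ _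
        (measure_mono_null (t := {p.φLoS v}) (fun r hr => ?_) (by simp))
      have h : p.linkScore (r, false) = v := hr.1
      have h0 : (0 : ℝ) < r := hr.2
      rw [Set.mem_singleton_iff, ← h]
      simp [linkScore, p.φLoS_φNLoS h0.le]
  measure_neg := by
    rw [p.linkIntensity_score_lt le_rfl]
    have : p.φLoS 0 = 0 := by
      rw [φLoS, Real.zero_rpow (div_pos p.αLoS_pos p.αNLoS_pos).ne', mul_zero]
    simp [this, Θ, Ξ]

lemma ae_length_pos : ∀ᵐ y ∂p.linkIntensity, 0 < y.1 := by
  have hB : MeasurableSet {y : ℝ × Bool | y.1 ≤ 0} := measurable_fst measurableSet_Iic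
  have hempty : ∀ b : Bool, {r : ℝ | (r, b) ∈ {y : ℝ × Bool | y.1 ≤ 0}} ∩ Set.Ioi 0 = ∅ :=
    fun b => Set.eq_empty_of_forall_notMem fun r hr =>
      absurd (show (0 : ℝ) < r from hr.2) (not_lt.2 (show r ≤ 0 from hr.1))
  rw [ae_iff]
  simp only [not_lt]
  rw [p.linkIntensity_apply hB, hempty, hempty]
  simp

/-- For a NLoS link of length `r` the score is `φNLoS r`, so `Θ` is taken at `φNLoS r` and `Ξ` at
`φLoS (φNLoS r) = r`. -/
lemma voidProb_eq {y : ℝ × Bool} (hy : 0 < y.1) :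
    IsScore.voidProb p.linkIntensity p.linkScore y =
      ENNReal.ofReal (if y.2 then p.expLoS y.1 else p.expNLoS y.1) := by
  have hV := (p.linkScore_pos hy).le
  have hρ : 0 ≤ 2 * Real.pi * p.ρ := by have := p.ρ_pos; positivity
  rw [IsScore.voidProb, cumScore, p.linkIntensity_score_lt hV, ENNReal.toReal_ofReal
    (mul_nonneg hρ (add_nonneg (p.Θ_nonneg hV) (p.Ξ_nonneg (p.φLoS_nonneg hV))))]
  obtain ⟨r, b⟩ := y
  have hr : (0 : ℝ) < r := hy
  cases b
  · simp only [linkScore, expNLoS, Bool.false_eq_true, if_false]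
    rw [p.φLoS_φNLoS hr.le]
    congr 2; ring
  · simp only [linkScore, expLoS, if_true]
    congr 2; ring

end Params

namespace Network.IsModel

variable {Ω : Type*} [MeasurableSpace Ω] {μ : Measure Ω} {W : Network Ω} {p : Params}

/-- The length and the LoS state of a link. -/
noncomputable abbrev _root_.MmWave.Network.link (W : Network Ω) (k : ℕ) (ω : Ω) : ℝ × Bool :=
  (‖W.pos k ω‖, W.los k ω)

/-- Length zero must be excluded: there the real power is `0` by convention, so the path loss law
would rank the link last while its score ranks it first. -/
lemma ae_norm_pos_pos [IsProbabilityMeasure μ] (hW : W.IsModel p μ) :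
    ∀ᵐ ω ∂μ, ∀ k, 0 < ‖W.pos k ω‖ := by
  rw [ae_all_iff]
  intro k
  have hB : MeasurableSet {y : ℝ × Bool | ¬ 0 < y.1} := (measurable_fst measurableSet_Ioi).compl
  have hzero := ae_iff.1 p.ae_length_pos
  have hsum := hW.hasPoissonPGFL.tsum_measure_preimage hB (by rw [hzero]; exact ENNReal.zero_ne_top)
  rw [hzero, ENNReal.tsum_eq_zero] at hsum
  exact ae_iff.2 (hsum k)

/-- Almost surely the serving BS is the only best one. -/
lemma ae_mem_bestSet_iff [IsProbabilityMeasure μ] (hW : W.IsModel p μ) :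
    ∀ᵐ ω ∂μ, ∀ k, ω ∈ HasPoissonPGFL.bestSet W.link p.linkScore k ↔ k = W.serving p ω := by
  filter_upwards [hW.ae_norm_pos_pos,
    hW.hasPoissonPGFL.ae_existsUnique_best p.isScore_linkScore] with ω hpos hex
  obtain ⟨k₀, hk₀, huniq⟩ := hex
  have hset : {k | ∀ j, p.pathLoss (W.los j ω) (W.dist j ω) ≤
      p.pathLoss (W.los k ω) (W.dist k ω)} = {k₀} := by
    ext k
    have : (∀ j, p.pathLoss (W.los j ω) (W.dist j ω) ≤ p.pathLoss (W.los k ω) (W.dist k ω)) ↔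
        ω ∈ HasPoissonPGFL.bestSet W.link p.linkScore k :=
      forall_congr' fun j => p.pathLoss_le_iff (y := W.link j ω) (z := W.link k ω) (hpos j) (hpos k)
    rw [Set.mem_ofPred_eq, this, Set.mem_singleton_iff]
    exact ⟨fun h => huniq k h, fun h => h ▸ hk₀⟩
  have hs : W.serving p ω = k₀ := by
    rw [Network.serving, hset]
    exact csInf_singleton k₀
  intro k
  rw [hs]
  exact ⟨fun h => huniq k h, fun h => h ▸ hk₀⟩

end Network.IsModel

end MmWave

/-! ### Beam patterns and their mean. -/

lemma Real.countable_setOf_sin_eq (c : ℝ) : {x : ℝ | Real.sin x = c}.Countable := by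
  rcases Set.eq_empty_or_nonempty {x : ℝ | Real.sin x = c} with h | ⟨x₀, hx₀⟩
  · rw [h]; exact Set.countable_empty
  · refine ((Set.countable_range fun k : ℤ => 2 * (k : ℝ) * Real.pi + x₀).union
      (Set.countable_range fun k : ℤ => (2 * (k : ℝ) + 1) * Real.pi - x₀)).mono fun x hx => ?_
    have hx0 : Real.sin x₀ = c := hx₀
    have hx' : Real.sin x = c := hx
    obtain ⟨k, hk | hk⟩ := Real.sin_eq_sin_iff.1 (hx0.trans hx'.symm)
    · exact Or.inl ⟨k, hk.symm⟩
    · exact Or.inr ⟨k, hk.symm⟩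

lemma Complex.sq_norm_exp_mul_I_sub_one (x : ℝ) :
    ‖Complex.exp (x * Complex.I) - 1‖ ^ 2 = 2 * (1 - Real.cos x) := by
  rw [← Complex.normSq_eq_norm_sq, Complex.exp_mul_I, ← Complex.ofReal_cos, ← Complex.ofReal_sin,
    Complex.normSq_apply]
  simp only [Complex.sub_re, Complex.add_re, Complex.mul_re, Complex.ofReal_re, Complex.ofReal_im,
    Complex.I_re, Complex.I_im, Complex.one_re, Complex.sub_im, Complex.add_im, Complex.mul_im,
    Complex.one_im]
  nlinarith [Real.sin_sq_add_cos_sq x]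

/-- The geometric sum is a quotient of two differences `e^{iy} - 1`, each of squared norm `2 (1 -
cos y)`. -/
lemma Complex.sq_norm_geom_sum_exp {x : ℝ} (hx : Real.cos x ≠ 1) (n : ℕ) :
    ‖∑ i ∈ Finset.range n, Complex.exp (x * Complex.I) ^ i‖ ^ 2 =
      (1 - Real.cos (n * x)) / (1 - Real.cos x) := by
  have h1 : Complex.exp (x * Complex.I) ≠ 1 := fun h => by
    have := Complex.sq_norm_exp_mul_I_sub_one x
    rw [h, sub_self, norm_zero] at this
    exact hx (by linarith)
  have h2 : Complex.exp (x * Complex.I) ^ n = Complex.exp (((n * x : ℝ) : ℂ) * Complex.I) := by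
    rw [← Complex.exp_nat_mul]; push_cast; ring_nf
  have h3 : 1 - Real.cos x ≠ 0 := fun h => hx (by linarith)
  rw [geom_sum_eq h1, norm_div, div_pow, h2, Complex.sq_norm_exp_mul_I_sub_one,
    Complex.sq_norm_exp_mul_I_sub_one, mul_div_mul_left _ _ two_ne_zero]

namespace MmWave

/-- The uniform distribution on `(0, 2π)`. -/
noncomputable abbrev angleLaw : Measure ℝ := cond volume (Set.Ioo 0 (2 * Real.pi))

lemma angleLaw_eq : angleLaw =
    ENNReal.ofReal (1 / (2 * Real.pi)) • volume.restrict (Set.Ioc 0 (2 * Real.pi)) := by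
  have h : (0 : ℝ) < 2 * Real.pi := by positivity
  rw [angleLaw, ProbabilityTheory.cond, Real.volume_Ioo, sub_zero, ← ENNReal.ofReal_inv_of_pos h, one_div,
    Measure.restrict_congr_set Ioo_ae_eq_Ioc]

lemma integral_angleLaw (f : ℝ → ℝ) :
    ∫ x, f x ∂angleLaw = 1 / (2 * Real.pi) * ∫ x in (0 : ℝ)..(2 * Real.pi), f x := by
  have h : (0 : ℝ) < 2 * Real.pi := by positivity
  rw [angleLaw_eq, integral_smul_measure, intervalIntegral.integral_of_le h.le,
    ENNReal.toReal_ofReal (by positivity), smul_eq_mul]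

instance : IsProbabilityMeasure angleLaw := by
  have h : (0 : ℝ) < 2 * Real.pi := by positivity
  exact cond_isProbabilityMeasure_of_finite (by simp [Real.pi_pos])
    (by rw [Real.volume_Ioo]; exact ENNReal.ofReal_ne_top)

namespace Params

variable (p : Params)

lemma arrayProd_eq (ℓ : ℕ) (θ ϑ : ℝ) :
    p.arrayProd ℓ θ ϑ = ∑ i ∈ Finset.range ℓ, Complex.exp (((-p.ϖ ϑ θ : ℝ) : ℂ) * Complex.I) ^ i := by
  rw [arrayProd, dotProduct, Finset.sum_range]
  refine Finset.sum_congr rfl fun n _ => ?_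
  rw [Pi.star_apply, arrayResponse, arrayResponse, Complex.star_def, ← Complex.exp_conj,
    ← Complex.exp_add, ← Complex.exp_nat_mul, map_mul, map_neg, Complex.conj_I, Complex.conj_ofReal]
  congr 1
  rw [ϖ]
  push_cast
  ring

lemma arrayProd_self (ℓ : ℕ) (θ : ℝ) : p.arrayProd ℓ θ θ = ℓ := by
  rw [arrayProd_eq]
  simp [ϖ]

lemma norm_arrayProd_le (ℓ : ℕ) (θ ϑ : ℝ) : ‖p.arrayProd ℓ θ ϑ‖ ≤ ℓ := by
  rw [arrayProd_eq]
  refine (norm_sum_le _ _).trans ?_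
  simp only [norm_pow, Complex.norm_exp_ofReal_mul_I, one_pow]
  simp

lemma sq_norm_arrayProd {ℓ : ℕ} {θ ϑ : ℝ} (h : Real.cos (p.ϖ ϑ θ) ≠ 1) :
    ‖p.arrayProd ℓ θ ϑ‖ ^ 2 = (1 - Real.cos (ℓ * p.ϖ ϑ θ)) / (1 - Real.cos (p.ϖ ϑ θ)) := by
  rw [arrayProd_eq, Complex.sq_norm_geom_sum_exp (by rwa [Real.cos_neg]), mul_neg, Real.cos_neg,
    Real.cos_neg]

lemma continuous_arrayProd (ℓ : ℕ) : Continuous fun x : ℝ × ℝ => p.arrayProd ℓ x.1 x.2 := by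
  simp only [arrayProd_eq, ϖ]
  fun_prop

lemma measurable_sq_norm_arrayProd (ℓ : ℕ) :
    Measurable fun x : ℝ × ℝ => ‖p.arrayProd ℓ x.1 x.2‖ ^ 2 :=
  ((p.continuous_arrayProd ℓ).norm.pow 2).measurable

/-- A cosine equal to one confines `sin ϑ` to countably many values, each taken countably often.
Only there does the quotient of cosines become `0 / 0 = 0` and differ from the squared array
product. -/
lemma ae_cos_ϖ_ne_one (θ : ℝ) : ∀ᵐ ϑ : ℝ, Real.cos (p.ϖ ϑ θ) ≠ 1 := by
  have hc : (⋃ n : ℤ, {ϑ : ℝ | Real.sin ϑ = n * p.wavelength / p.d + Real.sin θ}).Countable :=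
    Set.countable_iUnion fun n => Real.countable_setOf_sin_eq _
  rw [ae_iff]
  refine measure_mono_null (fun ϑ hϑ => ?_) (hc.measure_zero volume)
  have h1 : Real.cos (p.ϖ ϑ θ) = 1 := not_not.1 hϑ
  obtain ⟨n, hn⟩ := (Real.cos_eq_one_iff _).1 h1
  refine Set.mem_iUnion.2 ⟨n, ?_⟩
  have hd := p.d_pos.ne'
  have hw := p.wavelength_pos.ne'
  have hpi := Real.pi_ne_zero
  rw [ϖ] at hn
  have hn' : (n : ℝ) = p.d / p.wavelength * (Real.sin ϑ - Real.sin θ) := by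
    have : (2 * Real.pi) * (n : ℝ) =
        (2 * Real.pi) * (p.d / p.wavelength * (Real.sin ϑ - Real.sin θ)) := by linarith
    exact mul_left_cancel₀ (by positivity) this
  change Real.sin ϑ = n * p.wavelength / p.d + Real.sin θ
  rw [hn']
  field_simp
  ring

lemma integrable_sq_norm_arrayProd (ℓ : ℕ) :
    Integrable (fun x : ℝ × ℝ => ‖p.arrayProd ℓ x.1 x.2‖ ^ 2) (angleLaw.prod angleLaw) := by
  refine Integrable.of_bound (p.measurable_sq_norm_arrayProd ℓ).aestronglyMeasurable
    ((ℓ : ℝ) ^ 2) (ae_of_all _ fun x => ?_)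
  rw [Real.norm_of_nonneg (by positivity)]
  exact pow_le_pow_left₀ (norm_nonneg _) (p.norm_arrayProd_le ℓ _ _) 2

lemma meanPattern_eq (ℓ : ℕ) : p.meanPattern ℓ =
    ∫ x : ℝ × ℝ, ‖p.arrayProd ℓ x.1 x.2‖ ^ 2 ∂(angleLaw.prod angleLaw) := by
  rw [integral_prod _ (p.integrable_sq_norm_arrayProd ℓ)]
  simp only [integral_angleLaw]
  rw [meanPattern, ← intervalIntegral.integral_const_mul]
  refine intervalIntegral.integral_congr fun θ _ => ?_
  rw [← intervalIntegral.integral_const_mul, ← intervalIntegral.integral_const_mul]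
  refine intervalIntegral.integral_congr_ae ?_
  filter_upwards [p.ae_cos_ϖ_ne_one θ] with ϑ hϑ _
  rw [p.sq_norm_arrayProd hϑ]
  field_simp
  ring

lemma meanPattern_nonneg (ℓ : ℕ) : 0 ≤ p.meanPattern ℓ := by
  rw [p.meanPattern_eq]
  exact integral_nonneg fun _ => by positivity

/-- Received gain of a link, with the length truncated at the reference distance. -/
noncomputable def linkGain (y : ℝ × Bool) : ℝ := p.pathLoss y.2 (max y.1 p.D)

lemma measurable_linkGain : Measurable p.linkGain := by
  have h : ∀ α β : ℝ, Measurable fun y : ℝ × Bool => β * (max y.1 p.D) ^ (-α) := fun α β =>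
    ((measurable_fst.max measurable_const).pow_const _).const_mul _
  exact Measurable.ite (measurable_snd (measurableSet_singleton true)) (h _ _) (h _ _)

lemma linkGain_nonneg (y : ℝ × Bool) : 0 ≤ p.linkGain y := by
  have hmax : 0 < max y.1 p.D := lt_max_of_lt_right p.D_pos
  have := p.βLoS_pos
  have := p.βNLoS_pos
  rw [linkGain, pathLoss]
  split_ifs <;> positivity

end Params

/-- Aligned beams give the gain `N ^ 2 * M ^ 2` whatever the angles are, so nothing is needed about
`θo`. -/
lemma Network.En1_eq {Ω : Type*} (W : Network Ω) (p : Params) (ω : Ω) : W.En1 p ω =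
    ENNReal.ofReal (p.N * p.M * p.Pmm * p.linkGain (W.link (W.serving p ω) ω)) := by
  have hN : (p.N : ℝ) ≠ 0 := Nat.cast_ne_zero.2 p.N_pos.ne'
  have hM : (p.M : ℝ) ≠ 0 := Nat.cast_ne_zero.2 p.M_pos.ne'
  rw [Network.En1, p.arrayProd_self, p.arrayProd_self, norm_mul, Complex.norm_natCast,
    Complex.norm_natCast]
  congr 1
  rw [Params.linkGain]
  change p.Pmm / (p.N * p.M) * p.pathLoss (W.los (W.serving p ω) ω)
    (max ‖W.pos (W.serving p ω) ω‖ p.D) * (p.N * p.M : ℝ) ^ 2 = _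
  field_simp

/-! ### Mean powers as integrals against the link intensity. -/

namespace Network.IsModel

variable {Ω : Type*} [MeasurableSpace Ω] {μ : Measure Ω} {W : Network Ω} {p : Params}

lemma lintegral_sq_norm_arrayProd [IsProbabilityMeasure μ] {A B : Ω → ℝ} (hA : Measurable A)
    (hB : Measurable B) (hAu : pdf.IsUniform A (Set.Ioo 0 (2 * Real.pi)) μ)
    (hBu : pdf.IsUniform B (Set.Ioo 0 (2 * Real.pi)) μ) (hAB : IndepFun A B μ) (p : Params) (ℓ : ℕ) :
    ∫⁻ ω, ENNReal.ofReal (‖p.arrayProd ℓ (A ω) (B ω)‖ ^ 2) ∂μ = ENNReal.ofReal (p.meanPattern ℓ) := by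
  have hmap := (indepFun_iff_map_prod_eq_prod_map_map hA.aemeasurable hB.aemeasurable).1 hAB
  have hA' : μ.map A = angleLaw := hAu
  have hB' : μ.map B = angleLaw := hBu
  rw [hA', hB'] at hmap
  rw [p.meanPattern_eq, ofReal_integral_eq_lintegral_ofReal (p.integrable_sq_norm_arrayProd ℓ)
    (ae_of_all _ fun _ => by simp only [Pi.zero_apply]; positivity), ← hmap,
    lintegral_map (p.measurable_sq_norm_arrayProd ℓ).ennreal_ofReal (hA.prodMk hB)]

lemma lintegral_beams [IsProbabilityMeasure μ] (hW : W.IsModel p μ) (k : ℕ) :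
    ∫⁻ ω, ENNReal.ofReal (‖p.arrayProd p.N (W.θr ω) (W.ϑr k ω) *
      p.arrayProd p.M (W.ϑt k ω) (W.θt k ω)‖ ^ 2) ∂μ = ENNReal.ofReal p.hBar := by
  have hm : ∀ i, Measurable ((![W.θr, W.ϑr k, W.ϑt k, W.θt k] : Fin 4 → Ω → ℝ) i) := by
    intro i
    fin_cases i
    · exact hW.θr_measurable
    · exact hW.ϑr_measurable k
    · exact hW.ϑt_measurable k
    · exact hW.θt_measurable k
  have hi := hW.angles_indep k
  have h1 : IndepFun W.θr (W.ϑr k) μ := hi.indepFun (i := 0) (j := 1) (by decide)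
  have h2 : IndepFun (W.ϑt k) (W.θt k) μ := hi.indepFun (i := 2) (j := 3) (by decide)
  have h3 : IndepFun (fun ω => (W.θr ω, W.ϑr k ω)) (fun ω => (W.ϑt k ω, W.θt k ω)) μ :=
    hi.indepFun_prodMk_prodMk hm 0 1 2 3 (by decide) (by decide) (by decide) (by decide)
  have hN := (p.measurable_sq_norm_arrayProd p.N).ennreal_ofReal
  have hM := (p.measurable_sq_norm_arrayProd p.M).ennreal_ofReal
  have h4 := lintegral_mul_eq_lintegral_mul_lintegral_of_indepFun
    (hN.comp (hW.θr_measurable.prodMk (hW.ϑr_measurable k)))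
    (hM.comp ((hW.ϑt_measurable k).prodMk (hW.θt_measurable k))) (h3.comp hN hM)
  simp only [Function.comp_def, Pi.mul_apply] at h4
  rw [lintegral_sq_norm_arrayProd hW.θr_measurable (hW.ϑr_measurable k) hW.θr_uniform
    (hW.ϑr_uniform k) h1, lintegral_sq_norm_arrayProd (hW.ϑt_measurable k) (hW.θt_measurable k)
    (hW.ϑt_uniform k) (hW.θt_uniform k) h2, ← ENNReal.ofReal_mul (p.meanPattern_nonneg _)] at h4
  rw [Params.hBar, ← h4]
  refine lintegral_congr fun ω => ?_
  rw [norm_mul, mul_pow, ENNReal.ofReal_mul (by positivity)]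

/-- The beam patterns of an interfering link are independent of its gain. -/
lemma setLIntegral_gain_mul_beams [IsProbabilityMeasure μ] (hW : W.IsModel p μ) (k : ℕ) :
    ∫⁻ ω in (HasPoissonPGFL.bestSet W.link p.linkScore k)ᶜ, ENNReal.ofReal (p.linkGain (W.link k ω) *
      ‖p.arrayProd p.N (W.θr ω) (W.ϑr k ω) * p.arrayProd p.M (W.ϑt k ω) (W.θt k ω)‖ ^ 2) ∂μ =
    (∫⁻ ω in (HasPoissonPGFL.bestSet W.link p.linkScore k)ᶜ,
      ENNReal.ofReal (p.linkGain (W.link k ω)) ∂μ) * ENNReal.ofReal p.hBar := by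
  have hbest : MeasurableSet (HasPoissonPGFL.bestSet W.link p.linkScore k) :=
    hW.hasPoissonPGFL.measurableSet_bestSet p.isScore_linkScore k
  have hproj : ∀ j : ℕ, Measurable fun x : (ℕ → ℝ) × (ℕ → Bool) => (x.1 j, x.2 j) := fun j =>
    ((measurable_pi_apply j).comp measurable_fst).prodMk
      ((measurable_pi_apply j).comp measurable_snd)
  -- Being best depends only on the lengths and states of all links, so the event and the gain
  -- together are independent of the angles of link `k`.
  set S : Set ((ℕ → ℝ) × (ℕ → Bool)) :=
    {x | ∀ j, p.linkScore (x.1 k, x.2 k) ≤ p.linkScore (x.1 j, x.2 j)} with hSdef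
  have hS : MeasurableSet S := by
    rw [hSdef, Set.ofPred_forall]
    exact MeasurableSet.iInter fun j => measurableSet_le
      (p.measurable_linkScore.comp (hproj k)) (p.measurable_linkScore.comp (hproj j))
  have hF : Measurable (Sᶜ.indicator fun x => ENNReal.ofReal (p.linkGain (x.1 k, x.2 k))) :=
    (p.measurable_linkGain.comp (hproj k)).ennreal_ofReal.indicator hS.compl
  have hG : Measurable fun x : ℝ × ℝ × ℝ × ℝ => ENNReal.ofReal
      (‖p.arrayProd p.N x.1 x.2.1 * p.arrayProd p.M x.2.2.1 x.2.2.2‖ ^ 2) := by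
    have h1 := (p.continuous_arrayProd p.N).comp
      (continuous_fst.prodMk (continuous_fst.comp continuous_snd) :
        Continuous fun x : ℝ × ℝ × ℝ × ℝ => (x.1, x.2.1))
    have h2 := (p.continuous_arrayProd p.M).comp
      (continuous_snd.comp continuous_snd : Continuous fun x : ℝ × ℝ × ℝ × ℝ => x.2.2)
    exact ((h1.mul h2).norm.pow 2).measurable.ennreal_ofReal
  have hlinks : Measurable fun ω => ((fun j => ‖W.pos j ω‖), (fun j => W.los j ω)) :=
    (measurable_pi_lambda _ fun j => (hW.ppp.measurable j).norm).prodMk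
      (measurable_pi_lambda _ fun j => hW.los_measurable j)
  have hangles : Measurable fun ω => (W.θr ω, W.ϑr k ω, W.ϑt k ω, W.θt k ω) :=
    hW.θr_measurable.prodMk ((hW.ϑr_measurable k).prodMk
      ((hW.ϑt_measurable k).prodMk (hW.θt_measurable k)))
  have key := lintegral_mul_eq_lintegral_mul_lintegral_of_indepFun
    (hF.comp hlinks) (hG.comp hangles) ((hW.angles_indep_links k).symm.comp hF hG)
  simp only [Function.comp_def, Pi.mul_apply] at key
  rw [hW.lintegral_beams k] at key
  rw [← lintegral_indicator hbest.compl, ← lintegral_indicator hbest.compl]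
  refine Eq.trans (lintegral_congr fun ω => ?_) (key.trans ?_)
  · by_cases hω : ω ∈ HasPoissonPGFL.bestSet W.link p.linkScore k
    · have h' : ((fun j => ‖W.pos j ω‖), (fun j => W.los j ω)) ∈ S := hω
      simp [hω, h']
    · have h' : ((fun j => ‖W.pos j ω‖), (fun j => W.los j ω)) ∉ S := hω
      rw [Set.indicator_of_mem (Set.mem_compl hω), Set.indicator_of_mem (Set.mem_compl h'),
        ENNReal.ofReal_mul (p.linkGain_nonneg _)]
  · congr 1

/-- The random index of the serving station is replaced by a sum over fixed indices, which can be
integrated term by term and shows measurability. -/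
lemma ae_En1_eq [IsProbabilityMeasure μ] (hW : W.IsModel p μ) : ∀ᵐ ω ∂μ, W.En1 p ω =
    ∑' k, (HasPoissonPGFL.bestSet W.link p.linkScore k).indicator
      (fun ω => ENNReal.ofReal (p.N * p.M * p.Pmm * p.linkGain (W.link k ω))) ω := by
  filter_upwards [hW.ae_mem_bestSet_iff] with ω hω
  rw [Network.En1_eq, tsum_eq_single (W.serving p ω), Set.indicator_of_mem ((hω _).2 rfl)]
  exact fun k hk => Set.indicator_of_notMem (fun h => hk ((hω k).1 h)) _

lemma measurable_indicator_bestSet [IsProbabilityMeasure μ] (hW : W.IsModel p μ) (c : ℝ) (k : ℕ) :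
    Measurable ((HasPoissonPGFL.bestSet W.link p.linkScore k).indicator
      fun ω => ENNReal.ofReal (c * p.linkGain (W.link k ω))) :=
  ((p.measurable_linkGain.comp (hW.hasPoissonPGFL.measurable k)).const_mul c).ennreal_ofReal.indicator
    (hW.hasPoissonPGFL.measurableSet_bestSet p.isScore_linkScore k)

lemma aemeasurable_En1 [IsProbabilityMeasure μ] (hW : W.IsModel p μ) :
    AEMeasurable (W.En1 p) μ :=
  ⟨_, Measurable.tsum fun k => hW.measurable_indicator_bestSet _ k, hW.ae_En1_eq⟩

lemma lintegral_En1 [IsProbabilityMeasure μ] (hW : W.IsModel p μ) :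
    ∫⁻ ω, W.En1 p ω ∂μ = ∫⁻ y, ENNReal.ofReal (p.N * p.M * p.Pmm * p.linkGain y) *
      IsScore.voidProb p.linkIntensity p.linkScore y ∂p.linkIntensity := by
  rw [lintegral_congr_ae hW.ae_En1_eq,
    lintegral_tsum fun k => (hW.measurable_indicator_bestSet _ k).aemeasurable,
    ← hW.hasPoissonPGFL.tsum_lintegral_bestSet p.isScore_linkScore
      ((p.measurable_linkGain.const_mul _).ennreal_ofReal)]
  exact tsum_congr fun k =>
    lintegral_indicator (hW.hasPoissonPGFL.measurableSet_bestSet p.isScore_linkScore k) _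

/-- The interference terms share the angle `θr` and are dependent. A mean needs only one link at a
time, and each link yields the same factor `hBar`. -/
lemma lintegral_En2 [IsProbabilityMeasure μ] (hW : W.IsModel p μ) :
    ∫⁻ ω, W.En2 p ω ∂μ = ENNReal.ofReal (p.Pmm / (p.N * p.M)) * (ENNReal.ofReal p.hBar *
      ∫⁻ x, IsScore.voidProb p.linkIntensity p.linkScore x *
        ∫⁻ y in {y | p.linkScore x < p.linkScore y}, ENNReal.ofReal (p.linkGain y)
          ∂p.linkIntensity ∂p.linkIntensity) := by
  set T : ℕ → Ω → ℝ≥0∞ := fun k ω => ENNReal.ofReal (p.linkGain (W.link k ω) *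
    ‖p.arrayProd p.N (W.θr ω) (W.ϑr k ω) * p.arrayProd p.M (W.ϑt k ω) (W.θt k ω)‖ ^ 2) with hT
  have hbest : ∀ k, MeasurableSet (HasPoissonPGFL.bestSet W.link p.linkScore k) := fun k =>
    hW.hasPoissonPGFL.measurableSet_bestSet p.isScore_linkScore k
  have hTm : ∀ k, Measurable (T k) := fun k => by
    have h1 := (p.continuous_arrayProd p.N).measurable.comp
      (hW.θr_measurable.prodMk (hW.ϑr_measurable k))
    have h2 := (p.continuous_arrayProd p.M).measurable.comp
      ((hW.ϑt_measurable k).prodMk (hW.θt_measurable k))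
    exact ((p.measurable_linkGain.comp (hW.hasPoissonPGFL.measurable k)).mul
      ((h1.mul h2).norm.pow_const 2)).ennreal_ofReal
  have hae : ∀ᵐ ω ∂μ, W.En2 p ω = ENNReal.ofReal (p.Pmm / (p.N * p.M)) *
      ∑' k, (HasPoissonPGFL.bestSet W.link p.linkScore k)ᶜ.indicator (T k) ω := by
    filter_upwards [hW.ae_mem_bestSet_iff] with ω hω
    rw [Network.En2]
    congr 1
    have : ∀ k, (HasPoissonPGFL.bestSet W.link p.linkScore k)ᶜ.indicator (T k) ω =
        {k | k ≠ W.serving p ω}.indicator (fun k => T k ω) k := fun k => by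
      by_cases hk : k = W.serving p ω
      · have h1 := (hω k).2 hk
        rw [Set.indicator_of_notMem (Set.notMem_compl_iff.2 h1),
          Set.indicator_of_notMem (show k ∉ {k | k ≠ W.serving p ω} from fun h => h hk)]
      · have h1 : ω ∉ HasPoissonPGFL.bestSet W.link p.linkScore k := fun h => hk ((hω k).1 h)
        rw [Set.indicator_of_mem (Set.mem_compl h1),
          Set.indicator_of_mem (show k ∈ {k | k ≠ W.serving p ω} from hk)]
    simp only [this]
    rw [← tsum_subtype {k | k ≠ W.serving p ω} fun k => T k ω]
    rfl
  rw [lintegral_congr_ae hae, lintegral_const_mul' _ _ ENNReal.ofReal_ne_top,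
    lintegral_tsum fun k => ((hTm k).indicator (hbest k).compl).aemeasurable,
    ← hW.hasPoissonPGFL.tsum_lintegral_compl_bestSet p.isScore_linkScore
      p.measurable_linkGain.ennreal_ofReal, mul_comm (ENNReal.ofReal p.hBar),
    ← ENNReal.tsum_mul_right]
  congr 1
  refine tsum_congr fun k => ?_
  rw [lintegral_indicator (hbest k).compl]
  exact hW.setLIntegral_gain_mul_beams k

end Network.IsModel

end MmWave

/-! ### Explicit evaluation of the integrals. -/

namespace MmWave

namespace Params

variable (p : Params)

/-- Density, up to the factor `2πρ`, of the length of the serving link when its LoS state is `b`. -/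
noncomputable def servingDensity (b : Bool) (r : ℝ) : ℝ :=
  r * p.linkProb b r * if b then p.expLoS r else p.expNLoS r

lemma servingDensity_nonneg (b : Bool) {r : ℝ} (hr : 0 < r) : 0 ≤ p.servingDensity b r := by
  refine mul_nonneg (mul_nonneg hr.le (p.linkProb_nonneg b hr.le)) ?_
  cases b <;> exact (Real.exp_pos _).le

lemma linkDensity_mul_voidProb (b : Bool) {r : ℝ} (hr : 0 < r) :
    p.linkDensity b r * IsScore.voidProb p.linkIntensity p.linkScore (r, b) =
      ENNReal.ofReal (2 * Real.pi * p.ρ) * ENNReal.ofReal (p.servingDensity b r) := by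
  have hρ : 0 ≤ 2 * Real.pi * p.ρ := by have := p.ρ_pos; positivity
  rw [p.voidProb_eq (y := (r, b)) hr, linkDensity, servingDensity,
    ← ENNReal.ofReal_mul (mul_nonneg hρ (mul_nonneg hr.le (p.linkProb_nonneg b hr.le))),
    ← ENNReal.ofReal_mul hρ, mul_assoc (2 * Real.pi * p.ρ)]

/-- Mean of a function of the length and LoS state of the serving link. -/
lemma lintegral_voidProb_mul {G : ℝ × Bool → ℝ≥0∞} (hG : Measurable G) :
    ∫⁻ y, IsScore.voidProb p.linkIntensity p.linkScore y * G y ∂p.linkIntensity =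
      ENNReal.ofReal (2 * Real.pi * p.ρ) *
        ((∫⁻ r in Set.Ioi (0 : ℝ), G (r, true) * ENNReal.ofReal (p.servingDensity true r)) +
          ∫⁻ r in Set.Ioi (0 : ℝ), G (r, false) * ENNReal.ofReal (p.servingDensity false r)) := by
  have h : ∀ b : Bool, ∫⁻ r in Set.Ioi (0 : ℝ), p.linkDensity b r *
      (IsScore.voidProb p.linkIntensity p.linkScore (r, b) * G (r, b)) =
      ENNReal.ofReal (2 * Real.pi * p.ρ) *
        ∫⁻ r in Set.Ioi (0 : ℝ), G (r, b) * ENNReal.ofReal (p.servingDensity b r) := fun b => by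
    rw [← lintegral_const_mul' _ _ ENNReal.ofReal_ne_top]
    refine setLIntegral_congr_fun measurableSet_Ioi fun r hr => ?_
    rw [← mul_assoc, p.linkDensity_mul_voidProb b hr]
    ring
  have hm : Measurable fun y => IsScore.voidProb p.linkIntensity p.linkScore y * G y :=
    p.isScore_linkScore.measurable_voidProb.mul hG
  rw [p.lintegral_linkIntensity hm, h, h, mul_add]

/-- Up to the factor `2πρ`, the two serving densities have total mass at most one by
`lintegral_voidProb_le`. -/
lemma integrableOn_servingDensity (b : Bool) : IntegrableOn (p.servingDensity b) (Set.Ioi 0) := by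
  have hρ : 0 < 2 * Real.pi * p.ρ := by have := p.ρ_pos; positivity
  have hv : Measurable fun r : ℝ => IsScore.voidProb p.linkIntensity p.linkScore (r, b) :=
    p.isScore_linkScore.measurable_voidProb.comp (measurable_id.prodMk measurable_const)
  -- On positive lengths the exponential factor is `voidProb`, whose measurability is already known.
  have hmeas : AEStronglyMeasurable (p.servingDensity b) (volume.restrict (Set.Ioi 0)) := by
    refine AEStronglyMeasurable.congr (f := fun r => r * p.linkProb b r *
      (IsScore.voidProb p.linkIntensity p.linkScore (r, b)).toReal) ?_ ?_
    · exact ((measurable_id.mul (p.measurable_linkProb b)).mul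
        hv.ennreal_toReal).aestronglyMeasurable
    · refine (ae_restrict_iff' measurableSet_Ioi).2 (ae_of_all _ fun r hr => ?_)
      simp only
      rw [p.voidProb_eq (y := (r, b)) hr, servingDensity, ENNReal.toReal_ofReal]
      cases b <;> exact (Real.exp_pos _).le
  refine ⟨hmeas, ?_⟩
  have hnn : 0 ≤ᵐ[volume.restrict (Set.Ioi 0)] p.servingDensity b :=
    (ae_restrict_iff' measurableSet_Ioi).2 (ae_of_all _ fun r hr => p.servingDensity_nonneg b hr)
  rw [hasFiniteIntegral_iff_ofReal hnn]
  have hle := p.isScore_linkScore.lintegral_voidProb_le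
  have hone := p.lintegral_voidProb_mul (measurable_one (α := ℝ≥0∞))
  simp only [Pi.one_apply, mul_one, one_mul] at hone
  rw [hone] at hle
  have hfin : (∫⁻ r in Set.Ioi (0 : ℝ), ENNReal.ofReal (p.servingDensity true r)) +
      ∫⁻ r in Set.Ioi (0 : ℝ), ENNReal.ofReal (p.servingDensity false r) ≠ ∞ := fun htop => by
    rw [htop, ENNReal.mul_top (by simpa using hρ)] at hle
    exact absurd hle (by simp)
  rw [ENNReal.add_ne_top] at hfin
  cases b
  · exact hfin.2.lt_top
  · exact hfin.1.lt_top

/-- Mean gain of the serving link when its LoS state is `b`. -/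
lemma lintegral_gain_servingDensity (b : Bool) {α β c : ℝ} (hα : 0 < α) (hβ : 0 ≤ β) (hc : 0 ≤ c)
    (hpl : ∀ R, p.pathLoss b R = β * R ^ (-α)) :
    ∫⁻ r in Set.Ioi (0 : ℝ), ENNReal.ofReal (c * p.linkGain (r, b)) *
        ENNReal.ofReal (p.servingDensity b r) =
      ENNReal.ofReal (c * (β * p.D ^ (-α) * (∫ r in (0 : ℝ)..p.D, p.servingDensity b r) +
        β * ∫ r in Set.Ioi p.D, r ^ (-α) * p.servingDensity b r)) := by
  have hD := p.D_pos
  have hmax : ∀ r, 0 < max r p.D := fun r => lt_max_of_lt_right hD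
  set g : ℝ → ℝ := fun r => (max r p.D) ^ (-α) * p.servingDensity b r with hg
  -- Truncation at `D` bounds the gain by its value at `D`; this makes the lower bound finite for
  -- every exponent.
  have hint : IntegrableOn g (Set.Ioi 0) := by
    refine (p.integrableOn_servingDensity b).bdd_mul (c := p.D ^ (-α)) ?_ ?_
    · exact ((measurable_id.max measurable_const).pow_const _).aestronglyMeasurable
    · refine ae_of_all _ fun r => ?_
      rw [Real.norm_of_nonneg (Real.rpow_nonneg (hmax r).le _)]
      exact Real.rpow_le_rpow_of_nonpos hD (le_max_right _ _) (by linarith)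
  have hg0 : ∀ r, 0 < r → 0 ≤ g r := fun r hr =>
    mul_nonneg (Real.rpow_nonneg (hmax r).le _) (p.servingDensity_nonneg b hr)
  have hsub : Set.Ioi p.D ⊆ Set.Ioi 0 := Set.Ioi_subset_Ioi hD.le
  have hsplit : ∫ r in Set.Ioi 0, g r = p.D ^ (-α) * (∫ r in (0 : ℝ)..p.D, p.servingDensity b r) +
      ∫ r in Set.Ioi p.D, r ^ (-α) * p.servingDensity b r := by
    rw [← Set.Ioc_union_Ioi_eq_Ioi hD.le, setIntegral_union (Set.Ioc_disjoint_Ioi le_rfl)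
      measurableSet_Ioi (hint.mono_set Set.Ioc_subset_Ioi_self) (hint.mono_set hsub),
      intervalIntegral.integral_of_le hD.le, ← integral_const_mul]
    congr 1
    · refine setIntegral_congr_fun measurableSet_Ioc fun r hr => ?_
      simp only [hg, max_eq_right hr.2]
    · refine setIntegral_congr_fun measurableSet_Ioi fun r hr => ?_
      simp only [hg, max_eq_left (le_of_lt (show p.D < r from hr))]
  calc _ = ∫⁻ r in Set.Ioi (0 : ℝ), ENNReal.ofReal (c * β * g r) := by
        refine setLIntegral_congr_fun measurableSet_Ioi fun r hr => ?_
        simp only [hg, linkGain, hpl]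
        rw [← ENNReal.ofReal_mul
          (mul_nonneg hc (mul_nonneg hβ (Real.rpow_nonneg (hmax r).le _)))]
        congr 1; ring
    _ = ENNReal.ofReal (∫ r in Set.Ioi 0, c * β * g r) := by
        rw [ofReal_integral_eq_lintegral_ofReal (hint.const_mul _)]
        exact (ae_restrict_iff' measurableSet_Ioi).2 (ae_of_all _ fun r hr =>
          mul_nonneg (mul_nonneg hc hβ) (hg0 r hr))
    _ = _ := by
        rw [integral_const_mul, hsplit]
        congr 1; ring

lemma antitone_tailLoS : Antitone p.tailLoS := fun _ _ hab =>
  lintegral_mono_set (Set.Ioi_subset_Ioi hab)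

lemma antitone_tailNLoS : Antitone p.tailNLoS := fun _ _ hab =>
  lintegral_mono_set (Set.Ioi_subset_Ioi hab)

/-- Mean total gain of the links with a larger path loss than a given one. -/
lemma setLIntegral_linkGain {x : ℝ × Bool} (hx : 0 < x.1) :
    ∫⁻ y in {y | p.linkScore x < p.linkScore y}, ENNReal.ofReal (p.linkGain y) ∂p.linkIntensity =
      ENNReal.ofReal (2 * Real.pi * p.ρ * p.βLoS) * p.tailLoS (p.linkScore x) +
        ENNReal.ofReal (2 * Real.pi * p.ρ * p.βNLoS) * p.tailNLoS (p.φLoS (p.linkScore x)) := by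
  have hV := p.linkScore_pos hx
  have hφ := p.φLoS_nonneg hV.le
  have hS : MeasurableSet {y | p.linkScore x < p.linkScore y} :=
    measurableSet_lt measurable_const p.measurable_linkScore
  have hρ := p.ρ_pos
  have hmax : ∀ r, 0 < max r p.D := fun r => lt_max_of_lt_right p.D_pos
  -- One computation for both states, with `v` the length beyond which a link in state `b` has a
  -- larger score than `x`.
  have hpiece : ∀ (b : Bool) (v : ℝ) (α β : ℝ) (q : ℝ → ℝ), 0 ≤ v → 0 ≤ β →
      (∀ t, 0 < t → (p.linkScore x < p.linkScore (t, b) ↔ v < t)) →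
      (∀ R, p.pathLoss b R = β * R ^ (-α)) → (∀ t, p.linkProb b t = q t) →
      ∫⁻ t in Set.Ioi (0 : ℝ), p.linkDensity b t * {y | p.linkScore x < p.linkScore y}.indicator
        (fun y => ENNReal.ofReal (p.linkGain y)) (t, b) =
      ENNReal.ofReal (2 * Real.pi * p.ρ * β) *
        ∫⁻ t in Set.Ioi v, ENNReal.ofReal ((max t p.D) ^ (-α) * q t * t) := by
    intro b v α β q hv hβ hiff hpl hq
    have hv_meas : MeasurableSet (Set.Ioi v) := measurableSet_Ioi
    have hsub : Set.Ioi v ∩ Set.Ioi 0 = Set.Ioi v :=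
      Set.inter_eq_left.2 (Set.Ioi_subset_Ioi hv)
    rw [← lintegral_const_mul' _ _ ENNReal.ofReal_ne_top, ← hsub,
      ← Measure.restrict_restrict hv_meas, ← lintegral_indicator hv_meas]
    refine setLIntegral_congr_fun measurableSet_Ioi fun t ht => ?_
    have ht0 : (0 : ℝ) < t := ht
    by_cases hvt : v < t
    · have h1 : (t, b) ∈ {y | p.linkScore x < p.linkScore y} := (hiff t ht0).2 hvt
      simp only [Set.indicator_of_mem h1, Set.indicator_of_mem (Set.mem_Ioi.2 hvt)]
      have hq0 : 0 ≤ p.linkProb b t := p.linkProb_nonneg b ht0.le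
      rw [linkDensity, linkGain, hpl, ← hq, ← ENNReal.ofReal_mul (by positivity),
        ← ENNReal.ofReal_mul (by positivity)]
      congr 1; ring
    · have h1 : (t, b) ∉ {y | p.linkScore x < p.linkScore y} := fun h => hvt ((hiff t ht0).1 h)
      simp only [Set.indicator_of_notMem h1,
        Set.indicator_of_notMem (show t ∉ Set.Ioi v from hvt), mul_zero]
  rw [← lintegral_indicator hS, p.lintegral_linkIntensity
    (p.measurable_linkGain.ennreal_ofReal.indicator hS),
    hpiece true (p.linkScore x) p.αLoS p.βLoS p.fPr hV.le p.βLoS_pos.le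
      (fun t _ => by simp [linkScore]) (fun R => by simp [pathLoss]) (fun t => by simp [linkProb]),
    hpiece false (p.φLoS (p.linkScore x)) p.αNLoS p.βNLoS (fun t => 1 - p.fPr t) hφ p.βNLoS_pos.le
      (fun t ht => p.lt_φNLoS_iff ht hV.le) (fun R => by simp [pathLoss])
      (fun t => by simp [linkProb])]
  rfl

lemma hBar_nonneg : 0 ≤ p.hBar := mul_nonneg (p.meanPattern_nonneg _) (p.meanPattern_nonneg _)

end Params

namespace Network.IsModel

variable {Ω : Type*} [MeasurableSpace Ω] {μ : Measure Ω} {W : Network Ω} {p : Params}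

lemma lintegral_En1_eq_avgPowerLow [IsProbabilityMeasure μ] (hW : W.IsModel p μ) :
    ∫⁻ ω, W.En1 p ω ∂μ = ENNReal.ofReal p.avgPowerLow := by
  have hρ : 0 ≤ 2 * Real.pi * p.ρ := by have := p.ρ_pos; positivity
  have hD := p.D_pos
  have hc : (0 : ℝ) ≤ p.N * p.M * p.Pmm := by have := p.Pmm_pos; positivity
  have hnn : ∀ (b : Bool) (α β : ℝ), 0 ≤ β →
      0 ≤ β * p.D ^ (-α) * (∫ r in (0 : ℝ)..p.D, p.servingDensity b r) +
        β * ∫ r in Set.Ioi p.D, r ^ (-α) * p.servingDensity b r := fun b α β hβ => by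
    refine add_nonneg (mul_nonneg (mul_nonneg hβ (Real.rpow_nonneg hD.le _)) ?_)
      (mul_nonneg hβ (setIntegral_nonneg measurableSet_Ioi fun r hr => ?_))
    · rw [intervalIntegral.integral_of_le hD.le]
      exact setIntegral_nonneg measurableSet_Ioc fun r hr => p.servingDensity_nonneg b hr.1
    · have hr0 : 0 < r := hD.trans hr
      exact mul_nonneg (Real.rpow_nonneg hr0.le _) (p.servingDensity_nonneg b hr0)
  rw [hW.lintegral_En1]
  simp only [mul_comm _ (IsScore.voidProb p.linkIntensity p.linkScore _)]
  rw [p.lintegral_voidProb_mul ((p.measurable_linkGain.const_mul _).ennreal_ofReal),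
    p.lintegral_gain_servingDensity true p.αLoS_pos p.βLoS_pos.le hc
      (fun R => by simp [Params.pathLoss]),
    p.lintegral_gain_servingDensity false p.αNLoS_pos p.βNLoS_pos.le hc
      (fun R => by simp [Params.pathLoss]),
    ← ENNReal.ofReal_add (mul_nonneg hc (hnn _ _ _ p.βLoS_pos.le))
      (mul_nonneg hc (hnn _ _ _ p.βNLoS_pos.le)), ← ENNReal.ofReal_mul hρ, Params.avgPowerLow]
  have hpow : ∀ (b : Bool) (α : ℝ), ∫ r in Set.Ioi p.D, r ^ (-α) * p.servingDensity b r =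
      ∫ r in Set.Ioi p.D, r ^ (1 - α) * p.linkProb b r *
        if b then p.expLoS r else p.expNLoS r := fun b α => by
    refine setIntegral_congr_fun measurableSet_Ioi fun r hr => ?_
    have hr0 : 0 < r := hD.trans hr
    simp only [Params.servingDensity]
    rw [sub_eq_add_neg, Real.rpow_add hr0, Real.rpow_one]
    ring
  rw [hpow, hpow]
  simp only [Params.servingDensity, Params.linkProb, if_true, Bool.false_eq_true, if_false]
  congr 1
  ring

lemma lintegral_En2_eq_avgInterference [IsProbabilityMeasure μ] (hW : W.IsModel p μ) :
    ∫⁻ ω, W.En2 p ω ∂μ = p.avgInterference := by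
  have hρ : 0 ≤ 2 * Real.pi * p.ρ := by have := p.ρ_pos; positivity
  have hP : 0 ≤ p.Pmm / (p.N * p.M) := by have := p.Pmm_pos; positivity
  have hh := p.hBar_nonneg
  have hL := p.βLoS_pos.le
  have hN := p.βNLoS_pos.le
  have hTL : Measurable fun x => p.tailLoS (p.linkScore x) :=
    p.antitone_tailLoS.measurable.comp p.measurable_linkScore
  have hTN : Measurable fun x => p.tailNLoS (p.φLoS (p.linkScore x)) :=
    p.antitone_tailNLoS.measurable.comp (p.measurable_φLoS.comp p.measurable_linkScore)
  have hm : Measurable fun x => ENNReal.ofReal (2 * Real.pi * p.ρ * p.βLoS) *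
      (IsScore.voidProb p.linkIntensity p.linkScore x * p.tailLoS (p.linkScore x)) :=
    (p.isScore_linkScore.measurable_voidProb.mul hTL).const_mul _
  have hsplit : ∫⁻ x, IsScore.voidProb p.linkIntensity p.linkScore x *
        ∫⁻ y in {y | p.linkScore x < p.linkScore y}, ENNReal.ofReal (p.linkGain y)
          ∂p.linkIntensity ∂p.linkIntensity =
      ENNReal.ofReal (2 * Real.pi * p.ρ * p.βLoS) *
        (∫⁻ x, IsScore.voidProb p.linkIntensity p.linkScore x * p.tailLoS (p.linkScore x)
          ∂p.linkIntensity) +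
      ENNReal.ofReal (2 * Real.pi * p.ρ * p.βNLoS) *
        ∫⁻ x, IsScore.voidProb p.linkIntensity p.linkScore x *
          p.tailNLoS (p.φLoS (p.linkScore x)) ∂p.linkIntensity := by
    rw [← lintegral_const_mul' _ _ ENNReal.ofReal_ne_top,
      ← lintegral_const_mul' _ _ ENNReal.ofReal_ne_top,
      ← lintegral_add_left hm]
    refine lintegral_congr_ae ?_
    filter_upwards [p.ae_length_pos] with x hx
    rw [p.setLIntegral_linkGain hx]
    ring
  have hsc : ∀ r : ℝ, p.linkScore (r, true) = r := fun r => by simp [Params.linkScore]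
  have hsc' : ∀ r : ℝ, p.linkScore (r, false) = p.φNLoS r := fun r => by simp [Params.linkScore]
  -- When serving and interfering links are both NLoS, the threshold is the serving length itself.
  have hinv : ∫⁻ r in Set.Ioi (0 : ℝ), p.tailNLoS (p.φLoS (p.φNLoS r)) *
        ENNReal.ofReal (p.servingDensity false r) =
      ∫⁻ r in Set.Ioi (0 : ℝ), p.tailNLoS r * ENNReal.ofReal (p.servingDensity false r) :=
    setLIntegral_congr_fun measurableSet_Ioi fun r hr => by
      simp only [p.φLoS_φNLoS (le_of_lt (show (0 : ℝ) < r from hr))]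
  rw [hW.lintegral_En2, hsplit, p.lintegral_voidProb_mul hTL, p.lintegral_voidProb_mul hTN]
  simp only [hsc, hsc']
  rw [hinv]
  have hdt : p.servingDensity true = fun r => r * p.fPr r * p.expLoS r := by
    funext r; simp [Params.servingDensity, Params.linkProb]
  have hdf : p.servingDensity false = fun r => r * (1 - p.fPr r) * p.expNLoS r := by
    funext r; simp [Params.servingDensity, Params.linkProb]
  -- One factor `2πρ` comes from the density of the serving link, the other from that of the
  -- interferers.
  have hconst : ∀ β : ℝ, 0 ≤ β →
      ENNReal.ofReal (p.Pmm / (p.N * p.M) * p.hBar * β * (2 * Real.pi * p.ρ) ^ 2) =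
        ENNReal.ofReal (p.Pmm / (p.N * p.M)) * (ENNReal.ofReal p.hBar *
          (ENNReal.ofReal (2 * Real.pi * p.ρ * β) * ENNReal.ofReal (2 * Real.pi * p.ρ))) :=
    fun β hβ => by
      rw [← ENNReal.ofReal_mul (mul_nonneg hρ hβ), ← ENNReal.ofReal_mul hh,
        ← ENNReal.ofReal_mul hP]
      congr 1; ring
  rw [Params.avgInterference, hconst _ hL, hconst _ hN, hdt, hdf]
  ring

end Network.IsModel

end MmWave

theorem theorem1 {Ω : Type*} [MeasurableSpace Ω] (μ : Measure Ω) [IsProbabilityMeasure μ]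
    (p : MmWave.Params) (W : MmWave.Network Ω) (hW : W.IsModel p μ) :
    (∫⁻ ω, W.receivedPower p ω ∂μ = ∫⁻ ω, W.En1 p ω ∂μ + ∫⁻ ω, W.En2 p ω ∂μ) ∧
    (∫⁻ ω, W.receivedPower p ω ∂μ = ENNReal.ofReal p.avgPowerLow + p.avgInterference) ∧
    (∫⁻ ω, W.En1 p ω ∂μ = ENNReal.ofReal p.avgPowerLow) ∧
    (∫⁻ ω, W.En1 p ω ∂μ ≤ ∫⁻ ω, W.receivedPower p ω ∂μ) := by
  -- Additivity of the integral requires measurability of only one summand, here `En1`.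
  have hadd : ∫⁻ ω, W.receivedPower p ω ∂μ = ∫⁻ ω, W.En1 p ω ∂μ + ∫⁻ ω, W.En2 p ω ∂μ :=
    lintegral_add_left' hW.aemeasurable_En1 _
  refine ⟨hadd, ?_, hW.lintegral_En1_eq_avgPowerLow, ?_⟩
  · rw [hadd, hW.lintegral_En1_eq_avgPowerLow, hW.lintegral_En2_eq_avgInterference]
  · rw [hadd]
    exact le_self_add
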